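/- We work in homotopy type theory (HoTT): dependent type theory with a hierarchy of univalent universes, function extensionality, and pushouts, the circle $S^1$ and set truncation as higher inductive types; all pullbacks and pushouts are homotopy pullbacks and pushouts, in particular $A\times_C B:=\Sigma(x:A).\Sigma(y:B).(f(x)=g(y))$ for $f:A\to C$ and $g:B\to C$. The join of $f$ and $g$ is the map $f\ast g:A\ast_C B\to C$ induced by $f$ and $g$, where $A\ast_C B$ is the pushout of the projections $A\leftarrow A\times_C B\to B$. The iterated joins of $f:A\to C$ are given by $f^{\ast 0}:0\to C$ (with $0$ the empty type) and $f^{\ast(n+1)}:=f^{\ast n}\ast f$. Let $m\ge 1$, let $B\mathbb Z_m$ be a delooping of $\mathbb Z_m$ (a pointed connected type with an isomorphism of groups $\mathbb Z_m\simeq\Omega B\mathbb Z_m$), and let $B\phi:S^1\to B\mathbb Z_m$ be a pointed map which deloops the morphism $\phi:\mathbb Z\to\mathbb Z_m$ with $\phi(1)=1$, that is, $\Omega(B\phi)$ sends the generating loop of $S^1$ to the loop corresponding to $1\in\mathbb Z_m$. Let $L^n$ be the source of $(B\phi)^{\ast n}:L^n\to B\mathbb Z_m$, so that $L^0=0$ and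 $L^{n+1}=L^n\ast_{B\mathbb Z_m}S^1$. Let $R:=S^1\times_{B\mathbb Z_m}S^1$, and let $R^{\ast n}$ be the source of the $n$-th iterated join, over $S^1$, of the second projection $R\to S^1$. Theorem. It is provable in HoTT that, for every $m\ge1$, $B\mathbb Z_m$ and $B\phi$ as above and every $n:\mathbb N$, there is an equality of types $$L^n\times_{B\mathbb Z_m}S^1=R^{\ast n}$$ under which the second projection $L^n\times_{B\mathbb Z_m}S^1\to S^1$ corresponds to the iterated join $R^{\ast n}\to S^1$, and the square $$\begin{array}{ccc}R^{\ast n}&\longrightarrow&S^1\\ \downarrow&&\downarrow\\ L^n&\longrightarrow&L^{n+1}\end{array}$$ is a pushout, where the left map corresponds to the first projection $L^n\times_{B\mathbb Z_m}S^1\to L^n$, the other two maps into $L^{n+1}$ are the inclusions into the join $L^n\ast_{B\mathbb Z_m}S^1$, and the square commutes by the path that defines this join. -/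

import Mathlib

/-!
Homotopy type theory, as a formal system, in the style of the first presentation in the appendix
of the HoTT book: a dependent lambda calculus with a cumulative hierarchy of universes, primitive
constants with given types, computation rules, and the axioms of function extensionality and
univalence. Only those type formers are included that are needed below: dependent products and
sums, the empty type, natural numbers, identity types, the circle, pushouts and set truncation.
A theorem of homotopy type theory is a closed type together with a closed term of that type.
-/

namespace HoTT

/-- The primitive constants; `i` and `j` are universe levels (`j` is the level of the family into
which an eliminator eliminates). -/
inductive Const : Type
  | sigma (i : ℕ) | pair (i : ℕ) | sigmaInd (i j : ℕ)
  | empty | emptyInd (j : ℕ)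
  | nat | zero | succ | natInd (j : ℕ)
  | eq (i : ℕ) | refl (i : ℕ) | eqInd (i j : ℕ)
  | circle | base | loop | circleInd (j : ℕ) | circleLoop (j : ℕ)
  | pushout (i : ℕ) | inl (i : ℕ) | inr (i : ℕ) | glue (i : ℕ)
  | pushoutInd (i j : ℕ) | pushoutGlue (i j : ℕ)
  | trunc (i : ℕ) | truncMk (i : ℕ) | truncSet (i : ℕ) | truncInd (i j : ℕ)
  | funext (i : ℕ) | univalence (i : ℕ)

/-- Raw terms (and types), with de Bruijn indices. -/
inductive Raw : Type
  | var (n : ℕ)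
  | const (c : Const)
  | univ (i : ℕ)
  | pi (A B : Raw)
  | lam (A t : Raw)
  | app (f a : Raw)

namespace Raw

/-- Extension of a renaming under a binder. -/
def liftRen (ρ : ℕ → ℕ) : ℕ → ℕ
  | 0 => 0
  | n + 1 => ρ n + 1

/-- Renaming of variables. -/
def rename : Raw → (ℕ → ℕ) → Raw
  | var n, ρ => var (ρ n)
  | const c, _ => const c
  | univ i, _ => univ i
  | pi A B, ρ => pi (A.rename ρ) (B.rename (liftRen ρ))
  | lam A t, ρ => lam (A.rename ρ) (t.rename (liftRen ρ))
  | app f a, ρ => app (f.rename ρ) (a.rename ρ)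

/-- Extension of a substitution under a binder. -/
def liftSubst (σ : ℕ → Raw) : ℕ → Raw
  | 0 => var 0
  | n + 1 => (σ n).rename Nat.succ

/-- Simultaneous capture-avoiding substitution. -/
def subst : Raw → (ℕ → Raw) → Raw
  | var n, σ => σ n
  | const c, _ => const c
  | univ i, _ => univ i
  | pi A B, σ => pi (A.subst σ) (B.subst (liftSubst σ))
  | lam A t, σ => lam (A.subst σ) (t.subst (liftSubst σ))
  | app f a, σ => app (f.subst σ) (a.subst σ)

/-- The substitution of `a` for the variable `0`; the other variables are lowered by one. -/
def single (a : Raw) : ℕ → Raw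
  | 0 => a
  | n + 1 => var n

/-- `t[a/0]`. -/
def inst (t a : Raw) : Raw := t.subst (single a)

end Raw

/-! ### Terms with named bound variables

To write terms readably, a term is given as a function of the number of variables in scope, and a
binder takes a Lean function of the bound variable. A closed term `T : Term` stands for the raw
term `T 0`. -/

/-- A term, as a function of the number of variables in scope. -/
abbrev Term : Type := ℕ → Raw

/-- The variable that was bound when `d` variables were in scope. -/
def bound (d : ℕ) : Term := fun k => .var (k - 1 - d)

/-- `Π (x : A). B x`. -/
def pi (A : Term) (B : Term → Term) : Term := fun d => .pi (A d) (B (bound d) (d + 1))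

/-- `λ (x : A). t x`. -/
def lam (A : Term) (t : Term → Term) : Term := fun d => .lam (A d) (t (bound d) (d + 1))

/-- Application. -/
def app (f a : Term) : Term := fun d => .app (f d) (a d)

/-- The universe of level `i`. -/
def U (i : ℕ) : Term := fun _ => .univ i

/-- A primitive constant. -/
def cst (c : Const) : Term := fun _ => .const c

local infixl:90 " ⬝ " => app

/-- `A → B`. -/
def arrow (A B : Term) : Term := pi A fun _ => B

local infixr:50 " ⇒ " => arrow

/-! ### The primitive types and basic constructions -/

/-- `Σ (x : A). B x`. -/
def sigma (i : ℕ) (A : Term) (B : Term → Term) : Term := cst (.sigma i) ⬝ A ⬝ lam A B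

/-- The pair `(a, b) : Σ (x : A). B x`. -/
def pair (i : ℕ) (A : Term) (B : Term → Term) (a b : Term) : Term :=
  cst (.pair i) ⬝ A ⬝ lam A B ⬝ a ⬝ b

/-- The first projection, as a function of `A`, `B : A → U i` and `z : Σ (x : A). B x`. -/
def fstFun (i : ℕ) : Term :=
  lam (U i) fun A => lam (A ⇒ U i) fun B => lam (sigma i A fun x => B ⬝ x) fun z =>
    cst (.sigmaInd i i) ⬝ A ⬝ B ⬝ lam (sigma i A fun x => B ⬝ x) (fun _ => A) ⬝
      lam A (fun a => lam (B ⬝ a) fun _ => a) ⬝ z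

/-- The first projection of `z : Σ (x : A). B x`. -/
def fst (i : ℕ) (A : Term) (B : Term → Term) (z : Term) : Term := fstFun i ⬝ A ⬝ lam A B ⬝ z

/-- The second projection, as a function of `A`, `B : A → U i` and `z : Σ (x : A). B x`. -/
def sndFun (i : ℕ) : Term :=
  lam (U i) fun A => lam (A ⇒ U i) fun B => lam (sigma i A fun x => B ⬝ x) fun z =>
    cst (.sigmaInd i i) ⬝ A ⬝ B ⬝
      lam (sigma i A fun x => B ⬝ x) (fun w => B ⬝ (fstFun i ⬝ A ⬝ B ⬝ w)) ⬝
      lam A (fun a => lam (B ⬝ a) fun b => b) ⬝ z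

/-- The second projection of `z : Σ (x : A). B x`. -/
def snd (i : ℕ) (A : Term) (B : Term → Term) (z : Term) : Term := sndFun i ⬝ A ⬝ lam A B ⬝ z

/-- `A × B`. -/
def prod (i : ℕ) (A B : Term) : Term := sigma i A fun _ => B

/-- The empty type. -/
def empty : Term := cst .empty

/-- The type of natural numbers. -/
def nat : Term := cst .nat

def zero : Term := cst .zero

def succ (n : Term) : Term := cst .succ ⬝ n

/-- The identity type `x = y` of `A : U i`. -/
def eq (i : ℕ) (A x y : Term) : Term := cst (.eq i) ⬝ A ⬝ x ⬝ y

def refl (i : ℕ) (A x : Term) : Term := cst (.refl i) ⬝ A ⬝ x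

/-- Based path induction: from `c : C x refl`, an element of `C y p` for `p : x = y`. -/
def eqInd (i j : ℕ) (A x : Term) (C : Term → Term → Term) (c y p : Term) : Term :=
  cst (.eqInd i j) ⬝ A ⬝ x ⬝ lam A (fun y' => lam (eq i A x y') fun p' => C y' p') ⬝ c ⬝ y ⬝ p

/-- The inverse of `p : x = y`. -/
def symm (i : ℕ) (A x y p : Term) : Term :=
  eqInd i i A x (fun y' _ => eq i A y' x) (refl i A x) y p

/-- Concatenation of paths, as a function. -/
def transFun (i : ℕ) : Term :=
  lam (U i) fun A => lam A fun x => lam A fun y => lam A fun z =>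
    lam (eq i A x y) fun p => lam (eq i A y z) fun q =>
      eqInd i i A y (fun z' _ => eq i A x z') p z q

/-- The concatenation of `p : x = y` and `q : y = z`. -/
def trans (i : ℕ) (A x y z p q : Term) : Term := transFun i ⬝ A ⬝ x ⬝ y ⬝ z ⬝ p ⬝ q

/-- Substitution of `x` by `y` in the family `P`, along `p : x = y`, applied to `u : P x`. -/
def transport (i j : ℕ) (A : Term) (P : Term → Term) (x y p u : Term) : Term :=
  eqInd i j A x (fun y' _ => P y') u y p

/-- Application of a function to a path, as a function. -/
def apFun (i j : ℕ) : Term :=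
  lam (U i) fun A => lam (U j) fun B => lam (A ⇒ B) fun f => lam A fun x => lam A fun y =>
    lam (eq i A x y) fun p =>
      eqInd i j A x (fun y' _ => eq j B (f ⬝ x) (f ⬝ y')) (refl j B (f ⬝ x)) y p

/-- The path `f x = f y` induced by `p : x = y`, for `f : A → B`. -/
def ap (i j : ℕ) (A B f x y p : Term) : Term := apFun i j ⬝ A ⬝ B ⬝ f ⬝ x ⬝ y ⬝ p

/-- The path over `p : x = y` from `f x` to `f y`, for a dependent function `f`. -/
def apd (i j : ℕ) (A : Term) (P : Term → Term) (f x y p : Term) : Term :=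
  eqInd i j A x (fun y' p' => eq j (P y') (transport i j A P x y' p' (f ⬝ x)) (f ⬝ y'))
    (refl j (P x) (f ⬝ x)) y p

/-- Transport in a constant family is the identity, up to a path. -/
def transportConst (i j : ℕ) (A B x y p u : Term) : Term :=
  eqInd i j A x (fun y' p' => eq j B (transport i j A (fun _ => B) x y' p' u) u)
    (refl j B u) y p

def isContr (i : ℕ) (A : Term) : Term := sigma i A fun x => pi A fun y => eq i A x y

def isSet (i : ℕ) (A : Term) : Term :=
  pi A fun x => pi A fun y => pi (eq i A x y) fun p => pi (eq i A x y) fun q =>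
    eq i (eq i A x y) p q

/-- Left inverses of `f : A → B` up to homotopy. -/
def leftInv (i : ℕ) (A B f : Term) : Term :=
  sigma i (B ⇒ A) fun g => pi A fun x => eq i A (g ⬝ (f ⬝ x)) x

/-- Right inverses of `f : A → B` up to homotopy. -/
def rightInv (i : ℕ) (A B f : Term) : Term :=
  sigma i (B ⇒ A) fun g => pi B fun y => eq i B (f ⬝ (g ⬝ y)) y

/-- `f : A → B` is an equivalence: it has a left and a right inverse up to homotopy. -/
def isEquiv (i : ℕ) (A B f : Term) : Term := prod i (leftInv i A B f) (rightInv i A B f)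

/-- `isEquiv`, as a function of `A`, `B` and `f : A → B`. -/
def isEquivFun (i : ℕ) : Term :=
  lam (U i) fun A => lam (U i) fun B => lam (A ⇒ B) fun f => isEquiv i A B f

/-- The type of equivalences `A ≃ B`. -/
def equiv (i : ℕ) (A B : Term) : Term := sigma i (A ⇒ B) fun f => isEquiv i A B f

/-- The function underlying an equivalence. -/
def equivFun (i : ℕ) (A B e : Term) : Term := fst i (A ⇒ B) (fun f => isEquiv i A B f) e

/-- The identity function is an equivalence. -/
def idIsEquiv (i : ℕ) (A : Term) : Term :=
  let I := lam A fun x => x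
  pair i (leftInv i A A I) (fun _ => rightInv i A A I)
    (pair i (A ⇒ A) (fun g => pi A fun x => eq i A (g ⬝ (I ⬝ x)) x) I (lam A fun x => refl i A x))
    (pair i (A ⇒ A) (fun g => pi A fun y => eq i A (I ⬝ (g ⬝ y)) y) I (lam A fun x => refl i A x))

/-- The function `A → B` given by transport along an equality `p : A = B` of types. -/
def coe (i : ℕ) (A B p : Term) : Term :=
  lam A fun x => transport (i + 1) i (U i) (fun X => X) A B p x

/-- `coeInv`, as a function of `A`, `B` and `p : A = B`. -/
def coeInvFun (i : ℕ) : Term :=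
  lam (U i) fun A => lam (U i) fun B => lam (eq (i + 1) (U i) A B) fun p =>
    coe i B A (symm (i + 1) (U i) A B p)

/-- The inverse function `B → A` of `coe i A B p`. -/
def coeInv (i : ℕ) (A B p : Term) : Term := coeInvFun i ⬝ A ⬝ B ⬝ p

/-- The canonical map `(A = B) → (A ≃ B)`. -/
def idToEquiv (i : ℕ) (A B : Term) : Term :=
  lam (eq (i + 1) (U i) A B) fun p =>
    pair i (A ⇒ B) (fun f => isEquiv i A B f) (coe i A B p)
      (eqInd (i + 1) i (U i) A (fun X q => isEquiv i A X (coe i A X q)) (idIsEquiv i A) B p)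

/-- The canonical map `(f = g) → Π (x : A). f x = g x`. -/
def happly (i : ℕ) (A : Term) (B : Term → Term) (f g : Term) : Term :=
  lam (eq i (pi A B) f g) fun p =>
    eqInd i i (pi A B) f (fun h _ => pi A fun x => eq i (B x) (f ⬝ x) (h ⬝ x))
      (lam A fun x => refl i (B x) (f ⬝ x)) g p

/-- The circle. -/
def S1 : Term := cst .circle

def base : Term := cst .base

/-- The generating loop `base = base` of the circle. -/
def loop : Term := cst .loop

/-- The pushout of `f : X → A` and `g : X → B`. -/
def pushout (i : ℕ) (X A B f g : Term) : Term := cst (.pushout i) ⬝ X ⬝ A ⬝ B ⬝ f ⬝ g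

def inl (i : ℕ) (X A B f g a : Term) : Term := cst (.inl i) ⬝ X ⬝ A ⬝ B ⬝ f ⬝ g ⬝ a

def inr (i : ℕ) (X A B f g b : Term) : Term := cst (.inr i) ⬝ X ⬝ A ⬝ B ⬝ f ⬝ g ⬝ b

/-- The path `inl (f x) = inr (g x)`. -/
def glue (i : ℕ) (X A B f g x : Term) : Term := cst (.glue i) ⬝ X ⬝ A ⬝ B ⬝ f ⬝ g ⬝ x

/-- The set truncation `‖A‖₀`. -/
def trunc (i : ℕ) (A : Term) : Term := cst (.trunc i) ⬝ A

def truncMk (i : ℕ) (A a : Term) : Term := cst (.truncMk i) ⬝ A ⬝ a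

/-- The type of the path data for the eliminator of the pushout into the family `C`. -/
def pushoutPaths (i j : ℕ) (X A B f g C l r : Term) : Term :=
  pi X fun x => eq j (C ⬝ inr i X A B f g (g ⬝ x))
    (transport i j (pushout i X A B f g) (fun z => C ⬝ z) (inl i X A B f g (f ⬝ x))
      (inr i X A B f g (g ⬝ x)) (glue i X A B f g x) (l ⬝ (f ⬝ x)))
    (r ⬝ (g ⬝ x))

/-- Telescope of a span. -/
def piSpan (i : ℕ) (T : Term → Term → Term → Term → Term → Term) : Term :=
  pi (U i) fun X => pi (U i) fun A => pi (U i) fun B =>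
    pi (X ⇒ A) fun f => pi (X ⇒ B) fun g => T X A B f g

/-- The (closed) types of the primitive constants. -/
def Const.type : Const → Term
  | sigma i => pi (U i) fun A => (A ⇒ U i) ⇒ U i
  | pair i => pi (U i) fun A => pi (A ⇒ U i) fun B => pi A fun a => pi (B ⬝ a) fun _ =>
      HoTT.sigma i A fun x => B ⬝ x
  | sigmaInd i j => pi (U i) fun A => pi (A ⇒ U i) fun B =>
      pi (HoTT.sigma i A (fun x => B ⬝ x) ⇒ U j) fun C =>
      pi (pi A fun a => pi (B ⬝ a) fun b => C ⬝ HoTT.pair i A (fun x => B ⬝ x) a b) fun _ =>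
      pi (HoTT.sigma i A fun x => B ⬝ x) fun z => C ⬝ z
  | empty => U 0
  | emptyInd j => pi (HoTT.empty ⇒ U j) fun C => pi HoTT.empty fun x => C ⬝ x
  | nat => U 0
  | zero => HoTT.nat
  | succ => HoTT.nat ⇒ HoTT.nat
  | natInd j => pi (HoTT.nat ⇒ U j) fun C => pi (C ⬝ HoTT.zero) fun _ =>
      pi (pi HoTT.nat fun n => C ⬝ n ⇒ C ⬝ HoTT.succ n) fun _ => pi HoTT.nat fun n => C ⬝ n
  | eq i => pi (U i) fun A => A ⇒ A ⇒ U i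
  | refl i => pi (U i) fun A => pi A fun x => HoTT.eq i A x x
  | eqInd i j => pi (U i) fun A => pi A fun x =>
      pi (pi A fun y => HoTT.eq i A x y ⇒ U j) fun C =>
      pi (C ⬝ x ⬝ HoTT.refl i A x) fun _ =>
      pi A fun y => pi (HoTT.eq i A x y) fun p => C ⬝ y ⬝ p
  | circle => U 0
  | base => S1
  | loop => HoTT.eq 0 S1 HoTT.base HoTT.base
  | circleInd j => pi (S1 ⇒ U j) fun C => pi (C ⬝ HoTT.base) fun b =>
      pi (HoTT.eq j (C ⬝ HoTT.base)
        (transport 0 j S1 (fun x => C ⬝ x) HoTT.base HoTT.base HoTT.loop b) b) fun _ =>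
      pi S1 fun x => C ⬝ x
  | circleLoop j => pi (S1 ⇒ U j) fun C => pi (C ⬝ HoTT.base) fun b =>
      pi (HoTT.eq j (C ⬝ HoTT.base)
        (transport 0 j S1 (fun x => C ⬝ x) HoTT.base HoTT.base HoTT.loop b) b) fun l =>
      HoTT.eq j
        (HoTT.eq j (C ⬝ HoTT.base)
          (transport 0 j S1 (fun x => C ⬝ x) HoTT.base HoTT.base HoTT.loop b) b)
        (apd 0 j S1 (fun x => C ⬝ x) (cst (.circleInd j) ⬝ C ⬝ b ⬝ l)
          HoTT.base HoTT.base HoTT.loop) l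
  | pushout i => piSpan i fun _ _ _ _ _ => U i
  | inl i => piSpan i fun X A B f g => A ⇒ HoTT.pushout i X A B f g
  | inr i => piSpan i fun X A B f g => B ⇒ HoTT.pushout i X A B f g
  | glue i => piSpan i fun X A B f g => pi X fun x =>
      HoTT.eq i (HoTT.pushout i X A B f g) (HoTT.inl i X A B f g (f ⬝ x))
        (HoTT.inr i X A B f g (g ⬝ x))
  | pushoutInd i j => piSpan i fun X A B f g =>
      pi (HoTT.pushout i X A B f g ⇒ U j) fun C =>
      pi (pi A fun a => C ⬝ HoTT.inl i X A B f g a) fun l =>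
      pi (pi B fun b => C ⬝ HoTT.inr i X A B f g b) fun r =>
      pi (pushoutPaths i j X A B f g C l r) fun _ =>
      pi (HoTT.pushout i X A B f g) fun z => C ⬝ z
  | pushoutGlue i j => piSpan i fun X A B f g =>
      pi (HoTT.pushout i X A B f g ⇒ U j) fun C =>
      pi (pi A fun a => C ⬝ HoTT.inl i X A B f g a) fun l =>
      pi (pi B fun b => C ⬝ HoTT.inr i X A B f g b) fun r =>
      pi (pushoutPaths i j X A B f g C l r) fun h => pi X fun x =>
      HoTT.eq j
        (HoTT.eq j (C ⬝ HoTT.inr i X A B f g (g ⬝ x))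
          (transport i j (HoTT.pushout i X A B f g) (fun z => C ⬝ z)
            (HoTT.inl i X A B f g (f ⬝ x)) (HoTT.inr i X A B f g (g ⬝ x))
            (HoTT.glue i X A B f g x) (l ⬝ (f ⬝ x)))
          (r ⬝ (g ⬝ x)))
        (apd i j (HoTT.pushout i X A B f g) (fun z => C ⬝ z)
          (cst (.pushoutInd i j) ⬝ X ⬝ A ⬝ B ⬝ f ⬝ g ⬝ C ⬝ l ⬝ r ⬝ h)
          (HoTT.inl i X A B f g (f ⬝ x)) (HoTT.inr i X A B f g (g ⬝ x))
          (HoTT.glue i X A B f g x))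
        (h ⬝ x)
  | trunc i => U i ⇒ U i
  | truncMk i => pi (U i) fun A => A ⇒ HoTT.trunc i A
  | truncSet i => pi (U i) fun A => isSet i (HoTT.trunc i A)
  | truncInd i j => pi (U i) fun A => pi (HoTT.trunc i A ⇒ U j) fun C =>
      pi (pi (HoTT.trunc i A) fun z => isSet j (C ⬝ z)) fun _ =>
      pi (pi A fun a => C ⬝ HoTT.truncMk i A a) fun _ =>
      pi (HoTT.trunc i A) fun z => C ⬝ z
  | funext i => pi (U i) fun A => pi (A ⇒ U i) fun B =>
      pi (pi A fun x => B ⬝ x) fun f => pi (pi A fun x => B ⬝ x) fun g =>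
      isEquiv i (HoTT.eq i (pi A fun x => B ⬝ x) f g)
        (pi A fun x => HoTT.eq i (B ⬝ x) (f ⬝ x) (g ⬝ x)) (happly i A (fun x => B ⬝ x) f g)
  | univalence i => pi (U i) fun A => pi (U i) fun B =>
      isEquiv (i + 1) (HoTT.eq (i + 1) (U i) A B) (equiv i A B) (idToEquiv i A B)

/-! ### Judgments -/

/-- The computation rules of the eliminators on constructors. -/
inductive Comp : Raw → Raw → Prop
  | sigmaInd (i j i' : ℕ) (A B C s A' B' a b : Raw) :
      Comp (.app (.app (.app (.app (.app (.const (.sigmaInd i j)) A) B) C) s)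
          (.app (.app (.app (.app (.const (.pair i')) A') B') a) b))
        (.app (.app s a) b)
  | natIndZero (j : ℕ) (C z s : Raw) :
      Comp (.app (.app (.app (.app (.const (.natInd j)) C) z) s) (.const .zero)) z
  | natIndSucc (j : ℕ) (C z s n : Raw) :
      Comp (.app (.app (.app (.app (.const (.natInd j)) C) z) s) (.app (.const .succ) n))
        (.app (.app s n) (.app (.app (.app (.app (.const (.natInd j)) C) z) s) n))
  | eqInd (i j i' : ℕ) (A x C c y A' x' : Raw) :
      Comp (.app (.app (.app (.app (.app (.app (.const (.eqInd i j)) A) x) C) c) y)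
          (.app (.app (.const (.refl i')) A') x'))
        c
  | circleInd (j : ℕ) (C b l : Raw) :
      Comp (.app (.app (.app (.app (.const (.circleInd j)) C) b) l) (.const .base)) b
  | pushoutIndInl (i j i' : ℕ) (X A B f g C l r h X' A' B' f' g' a : Raw) :
      Comp (.app (.app (.app (.app (.app (.app (.app (.app (.app (.app (.const (.pushoutInd i j))
            X) A) B) f) g) C) l) r) h)
          (.app (.app (.app (.app (.app (.app (.const (.inl i')) X') A') B') f') g') a))
        (.app l a)
  | pushoutIndInr (i j i' : ℕ) (X A B f g C l r h X' A' B' f' g' b : Raw) :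
      Comp (.app (.app (.app (.app (.app (.app (.app (.app (.app (.app (.const (.pushoutInd i j))
            X) A) B) f) g) C) l) r) h)
          (.app (.app (.app (.app (.app (.app (.const (.inr i')) X') A') B') f') g') b))
        (.app r b)
  | truncInd (i j i' : ℕ) (A C h s A' a : Raw) :
      Comp (.app (.app (.app (.app (.app (.const (.truncInd i j)) A) C) h) s)
          (.app (.app (.const (.truncMk i')) A') a))
        (.app s a)

/-- Definitional equality: the congruence generated by the rules `β` and `η` for functions and the
computation rules. -/
inductive Conv : Raw → Raw → Prop
  | refl (t : Raw) : Conv t t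
  | symm {s t : Raw} : Conv s t → Conv t s
  | trans {s t u : Raw} : Conv s t → Conv t u → Conv s u
  | pi {A A' B B' : Raw} : Conv A A' → Conv B B' → Conv (.pi A B) (.pi A' B')
  | lam {A A' t t' : Raw} : Conv A A' → Conv t t' → Conv (.lam A t) (.lam A' t')
  | app {f f' a a' : Raw} : Conv f f' → Conv a a' → Conv (.app f a) (.app f' a')
  | beta (A t a : Raw) : Conv (.app (.lam A t) a) (t.inst a)
  | eta (A t : Raw) : Conv (.lam A (.app (t.rename Nat.succ) (.var 0))) t
  | comp {s t : Raw} : Comp s t → Conv s t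

/-- The judgment `Γ ⊢ t : A`. The head of the list `Γ` is the type of the variable `0`. A context
that arises in a derivation which ends in the empty context is automatically well formed, since
the rules for `Π` and `λ` require the domain to be a type. -/
inductive HasType : List Raw → Raw → Raw → Prop
  | var {Γ : List Raw} {n : ℕ} {A : Raw} : Γ[n]? = some A →
      HasType Γ (.var n) (A.rename (· + (n + 1)))
  | const (Γ : List Raw) (c : Const) : HasType Γ (.const c) (c.type 0)
  | univ (Γ : List Raw) (i : ℕ) : HasType Γ (.univ i) (.univ (i + 1))
  | cumul {Γ : List Raw} {A : Raw} {i : ℕ} :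
      HasType Γ A (.univ i) → HasType Γ A (.univ (i + 1))
  | pi {Γ : List Raw} {A B : Raw} {i : ℕ} : HasType Γ A (.univ i) →
      HasType (A :: Γ) B (.univ i) → HasType Γ (.pi A B) (.univ i)
  | lam {Γ : List Raw} {A B t : Raw} {i : ℕ} : HasType Γ A (.univ i) →
      HasType (A :: Γ) t B → HasType Γ (.lam A t) (.pi A B)
  | app {Γ : List Raw} {A B f a : Raw} : HasType Γ f (.pi A B) → HasType Γ a A →
      HasType Γ (.app f a) (B.inst a)
  | conv {Γ : List Raw} {A B t : Raw} {i : ℕ} : HasType Γ t A → Conv A B →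
      HasType Γ B (.univ i) → HasType Γ t B

/-- The closed type `T` is a theorem of homotopy type theory: it has a closed term. -/
def Provable (T : Term) : Prop := ∃ t : Raw, HasType [] t (T 0)

/-! ### Pullbacks and joins (of types in `U 0`)

The constructions from here on are closed functions of the type theory. -/

/-- A function of `X A B : U 0`, `f : X → A` and `g : X → B`. -/
def lamSpan (T : Term → Term → Term → Term → Term → Term) : Term :=
  lam (U 0) fun X => lam (U 0) fun A => lam (U 0) fun B =>
    lam (X ⇒ A) fun f => lam (X ⇒ B) fun g => T X A B f g

/-- A function of `A B C : U 0`, `f : A → C` and `g : B → C`. -/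
def lamCospan (T : Term → Term → Term → Term → Term → Term) : Term :=
  lam (U 0) fun A => lam (U 0) fun B => lam (U 0) fun C =>
    lam (A ⇒ C) fun f => lam (B ⇒ C) fun g => T A B C f g

/-- The function `A ⊔_X B → Y` given by a type `Y`, functions `l : A → Y` and `r : B → Y` and paths
`h x : l (f x) = r (g x)`. -/
def pushoutRec : Term :=
  lamSpan fun X A B f g =>
  lam (U 0) fun Y => lam (A ⇒ Y) fun l => lam (B ⇒ Y) fun r =>
  lam (pi X fun x => eq 0 Y (l ⬝ (f ⬝ x)) (r ⬝ (g ⬝ x))) fun h =>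
    let P := pushout 0 X A B f g
    cst (.pushoutInd 0 0) ⬝ X ⬝ A ⬝ B ⬝ f ⬝ g ⬝ lam P (fun _ => Y) ⬝ l ⬝ r ⬝
      lam X fun x =>
        let u := inl 0 X A B f g (f ⬝ x)
        let v := inr 0 X A B f g (g ⬝ x)
        let q := glue 0 X A B f g x
        trans 0 Y (transport 0 0 P (fun _ => Y) u v q (l ⬝ (f ⬝ x))) (l ⬝ (f ⬝ x)) (r ⬝ (g ⬝ x))
          (transportConst 0 0 P Y u v q (l ⬝ (f ⬝ x))) (h ⬝ x)

/-- The pullback `A ×_C B` of `f : A → C` and `g : B → C`, that is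
`Σ (x : A). Σ (y : B). f x = g y`. -/
def pullback : Term :=
  lamCospan fun A B C f g => sigma 0 A fun x => sigma 0 B fun y => eq 0 C (f ⬝ x) (g ⬝ y)

/-- The projection `A ×_C B → A`. -/
def pullbackFst : Term :=
  lamCospan fun A B C f g => lam (pullback ⬝ A ⬝ B ⬝ C ⬝ f ⬝ g) fun z =>
    fst 0 A (fun x => sigma 0 B fun y => eq 0 C (f ⬝ x) (g ⬝ y)) z

/-- The projection `A ×_C B → B`. -/
def pullbackSnd : Term :=
  lamCospan fun A B C f g => lam (pullback ⬝ A ⬝ B ⬝ C ⬝ f ⬝ g) fun z =>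
    let T := fun x => sigma 0 B fun y => eq 0 C (f ⬝ x) (g ⬝ y)
    fst 0 B (fun y => eq 0 C (f ⬝ fst 0 A T z) (g ⬝ y)) (snd 0 A T z)

/-- The path `f (fst z) = g (snd z)` in `C`, for `z : A ×_C B`. -/
def pullbackPath : Term :=
  lamCospan fun A B C f g => lam (pullback ⬝ A ⬝ B ⬝ C ⬝ f ⬝ g) fun z =>
    let T := fun x => sigma 0 B fun y => eq 0 C (f ⬝ x) (g ⬝ y)
    snd 0 B (fun y => eq 0 C (f ⬝ fst 0 A T z) (g ⬝ y)) (snd 0 A T z)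

/-- The source `A *_C B` of the join of `f : A → C` and `g : B → C`: the pushout of the projections
of the pullback `A ×_C B`. -/
def join : Term :=
  lamCospan fun A B C f g =>
    pushout 0 (pullback ⬝ A ⬝ B ⬝ C ⬝ f ⬝ g) A B (pullbackFst ⬝ A ⬝ B ⬝ C ⬝ f ⬝ g)
      (pullbackSnd ⬝ A ⬝ B ⬝ C ⬝ f ⬝ g)

/-- The join `f * g : A *_C B → C`. -/
def joinMap : Term :=
  lamCospan fun A B C f g =>
    pushoutRec ⬝ (pullback ⬝ A ⬝ B ⬝ C ⬝ f ⬝ g) ⬝ A ⬝ B ⬝ (pullbackFst ⬝ A ⬝ B ⬝ C ⬝ f ⬝ g) ⬝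
      (pullbackSnd ⬝ A ⬝ B ⬝ C ⬝ f ⬝ g) ⬝ C ⬝ f ⬝ g ⬝ (pullbackPath ⬝ A ⬝ B ⬝ C ⬝ f ⬝ g)

/-- A function of `A C : U 0`, `f : A → C` and `n : ℕ`. -/
def lamMap (T : Term → Term → Term → Term → Term) : Term :=
  lam (U 0) fun A => lam (U 0) fun C => lam (A ⇒ C) fun f => lam nat fun n => T A C f n

/-- The type of types (in `U 0`) over `C`. -/
def typeOver (C : Term) : Term := sigma 1 (U 0) fun X => X ⇒ C

/-- The `n`-th iterated join of `f : A → C`, as a type over `C`: the empty type for `n = 0`, and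
the join of the `n`-th one with `f` for `n + 1`. -/
def iterJoin : Term :=
  lamMap fun A C f n =>
    cst (.natInd 1) ⬝ lam nat (fun _ => typeOver C) ⬝
      pair 1 (U 0) (fun X => X ⇒ C) empty (cst (.emptyInd 0) ⬝ lam empty fun _ => C) ⬝
      lam nat (fun _ => lam (typeOver C) fun Y =>
        let X := fst 1 (U 0) (fun X => X ⇒ C) Y
        let u := snd 1 (U 0) (fun X => X ⇒ C) Y
        pair 1 (U 0) (fun X => X ⇒ C) (join ⬝ X ⬝ A ⬝ C ⬝ u ⬝ f) (joinMap ⬝ X ⬝ A ⬝ C ⬝ u ⬝ f)) ⬝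
      n

/-- The source of the `n`-th iterated join of `f : A → C`. -/
def iterJoinType : Term :=
  lamMap fun A C f n => fst 1 (U 0) (fun X => X ⇒ C) (iterJoin ⬝ A ⬝ C ⬝ f ⬝ n)

/-- The map to `C` from the source of the `n`-th iterated join of `f : A → C`. -/
def iterJoinMap : Term :=
  lamMap fun A C f n => snd 1 (U 0) (fun X => X ⇒ C) (iterJoin ⬝ A ⬝ C ⬝ f ⬝ n)

/-! ### The group `ℤ_m` and its deloopings -/

def add (a b : Term) : Term :=
  cst (.natInd 0) ⬝ lam nat (fun _ => nat) ⬝ a ⬝ lam nat (fun _ => lam nat fun r => succ r) ⬝ b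

def mul (a b : Term) : Term :=
  cst (.natInd 0) ⬝ lam nat (fun _ => nat) ⬝ zero ⬝ lam nat (fun _ => lam nat fun r => add r a) ⬝ b

/-- `k < m`. -/
def lt (k m : Term) : Term := sigma 0 nat fun j => eq 0 nat (add k (succ j)) m

/-- `ℤ_m`, as the set `{0, …, m - 1}`. -/
def zmod (m : Term) : Term := sigma 0 nat fun k => lt k m

/-- The number `0 ≤ k < m` that represents an element of `ℤ_m`. -/
def zmodVal (m x : Term) : Term := fst 0 nat (fun k => lt k m) x

/-- The element `x` of `ℤ_m` is the class of the natural number `a`: `a = x + q m` for some `q`. -/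
def isClass (m a x : Term) : Term :=
  sigma 0 nat fun q => eq 0 nat a (add (zmodVal m x) (mul q m))

/-- The loop space of `(B, b)`. -/
def Loop (B b : Term) : Term := eq 0 B b b

/-- `B` is connected: `‖B‖₀` is contractible. -/
def isConnected (B : Term) : Term := isContr 0 (trunc 0 B)

/-- The equivalence `e : ℤ_m ≃ Loop (B, b)` is a morphism of groups: if `z` is the class of
`x + y` then `e z` is the concatenation of `e x` and `e y`. -/
def isGroupHom (m B b e : Term) : Term :=
  let E := equivFun 0 (zmod m) (Loop B b) e
  pi (zmod m) fun x => pi (zmod m) fun y => pi (zmod m) fun z =>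
    isClass m (add (zmodVal m x) (zmodVal m y)) z ⇒
      eq 0 (Loop B b) (E ⬝ z) (trans 0 B b b b (E ⬝ x) (E ⬝ y))

/-- The loop of `(B, b)` that is the image of the generating loop of the circle under a map
`f : S¹ → B` which is pointed by `pf : f base = b`. -/
def loopImage (B b f pf : Term) : Term :=
  trans 0 B b (f ⬝ base) b (symm 0 B (f ⬝ base) b pf)
    (trans 0 B (f ⬝ base) (f ⬝ base) b (ap 0 0 S1 B f base base loop) pf)

/-- The pointed map `f : S¹ → B` deloops the morphism `ℤ → ℤ_m` that sends `1` to the class of `1`: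
it sends the generating loop to the loop that corresponds to the class of `1`. -/
def deloopsQuotient (m B b e f pf : Term) : Term :=
  pi (zmod m) fun x => isClass m (succ zero) x ⇒
    eq 0 (Loop B b) (loopImage B b f pf) (equivFun 0 (zmod m) (Loop B b) e ⬝ x)

/-! ### The pushout square

Let `u : X → B` and `f : A → B`, let `r : Y → A`, and let `p` be an equality of types
`X ×_B A = Y`. -/

/-- A function of `X A B : U 0`, `u : X → B`, `f : A → B`, `Y : U 0`, `r : Y → A` and
`p : X ×_B A = Y`. -/
def lamSquare (T : Term → Term → Term → Term → Term → Term → Term → Term → Term) : Term :=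
  lamCospan fun X A B u f => lam (U 0) fun Y => lam (Y ⇒ A) fun r =>
    lam (eq 1 (U 0) (pullback ⬝ X ⬝ A ⬝ B ⬝ u ⬝ f) Y) fun p => T X A B u f Y r p

/-- The map `Y → X ×_B A` given by `p`. -/
def toPullback (X A B u f Y p : Term) : Term := coeInv 0 (pullback ⬝ X ⬝ A ⬝ B ⬝ u ⬝ f) Y p

/-- The map `Y → X` that is the first projection of `X ×_B A` under `p`. -/
def leftMap : Term :=
  lamSquare fun X A B u f Y _ p => lam Y fun y =>
    pullbackFst ⬝ X ⬝ A ⬝ B ⬝ u ⬝ f ⬝ (toPullback X A B u f Y p ⬝ y)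

/-- The type which says that `p` is an equality of types over `A`: under `p`, the second projection
of `X ×_B A` becomes `r`. -/
def overBase : Term :=
  lamSquare fun X A B u f Y r p => pi Y fun y =>
    eq 0 A (pullbackSnd ⬝ X ⬝ A ⬝ B ⬝ u ⬝ f ⬝ (toPullback X A B u f Y p ⬝ y)) (r ⬝ y)

/-- The comparison map from the pushout of `X ← Y → A` to the join `X *_B A`, which is given by
`inl : X → X *_B A`, `inr : A → X *_B A`, and the path from `inl` to `inr` over a point of the
pullback `X ×_B A`, followed by the path `h : overBase`. -/
def comparison : Term :=
  lamSquare fun X A B u f Y r p =>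
  lam (overBase ⬝ X ⬝ A ⬝ B ⬝ u ⬝ f ⬝ Y ⬝ r ⬝ p) fun h =>
    let P := pullback ⬝ X ⬝ A ⬝ B ⬝ u ⬝ f
    let π₁ := pullbackFst ⬝ X ⬝ A ⬝ B ⬝ u ⬝ f
    let π₂ := pullbackSnd ⬝ X ⬝ A ⬝ B ⬝ u ⬝ f
    let J := join ⬝ X ⬝ A ⬝ B ⬝ u ⬝ f
    let i₁ := cst (.inl 0) ⬝ P ⬝ X ⬝ A ⬝ π₁ ⬝ π₂
    let i₂ := cst (.inr 0) ⬝ P ⬝ X ⬝ A ⬝ π₁ ⬝ π₂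
    pushoutRec ⬝ Y ⬝ X ⬝ A ⬝ (leftMap ⬝ X ⬝ A ⬝ B ⬝ u ⬝ f ⬝ Y ⬝ r ⬝ p) ⬝ r ⬝ J ⬝ i₁ ⬝ i₂ ⬝
      lam Y fun y =>
        let z := toPullback X A B u f Y p ⬝ y
        trans 0 J (i₁ ⬝ (π₁ ⬝ z)) (i₂ ⬝ (π₂ ⬝ z)) (i₂ ⬝ (r ⬝ y))
          (glue 0 P X A π₁ π₂ z) (ap 0 0 A J i₂ (π₂ ⬝ z) (r ⬝ y) (h ⬝ y))

/-! ### Lens spaces -/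

/-- `Lⁿ = (S¹)^{*ⁿ}`, the source of the `n`-th iterated join of `f : S¹ → B` over `B`. -/
def lens (B f n : Term) : Term := iterJoinType ⬝ S1 ⬝ B ⬝ f ⬝ n

/-- The map `f^{*n} : Lⁿ → B`. -/
def lensMap (B f n : Term) : Term := iterJoinMap ⬝ S1 ⬝ B ⬝ f ⬝ n

/-- `R = S¹ ×_B S¹`. -/
def rel (B f : Term) : Term := pullback ⬝ S1 ⬝ S1 ⬝ B ⬝ f ⬝ f

/-- The second projection `R → S¹`. -/
def relSnd (B f : Term) : Term := pullbackSnd ⬝ S1 ⬝ S1 ⬝ B ⬝ f ⬝ f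

/-- `R^{*n}`, the source of the `n`-th iterated join of the second projection `R → S¹` over `S¹`. -/
def relJoin (B f n : Term) : Term := iterJoinType ⬝ rel B f ⬝ S1 ⬝ relSnd B f ⬝ n

/-- The map `R^{*n} → S¹`. -/
def relJoinMap (B f n : Term) : Term := iterJoinMap ⬝ rel B f ⬝ S1 ⬝ relSnd B f ⬝ n

/-- `Lⁿ ×_B S¹ = R^{*n}` by some `p`, which is an equality of types over `S¹`, and the square with
corners `R^{*n}`, `S¹`, `Lⁿ` and `Lⁿ⁺¹` is a pushout: the comparison map from the pushout of
`Lⁿ ← R^{*n} → S¹` to `Lⁿ⁺¹` (which is `Lⁿ *_B S¹`) is an equivalence. -/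
def lensClaim (B f n : Term) : Term :=
  let L := lens B f n
  let u := lensMap B f n
  let Y := relJoin B f n
  let r := relJoinMap B f n
  sigma 1 (eq 1 (U 0) (pullback ⬝ L ⬝ S1 ⬝ B ⬝ u ⬝ f) Y) fun p =>
    sigma 0 (overBase ⬝ L ⬝ S1 ⬝ B ⬝ u ⬝ f ⬝ Y ⬝ r ⬝ p) fun h =>
      isEquivFun 0 ⬝
        pushout 0 Y L S1 (leftMap ⬝ L ⬝ S1 ⬝ B ⬝ u ⬝ f ⬝ Y ⬝ r ⬝ p) r ⬝
        lens B f (succ n) ⬝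
        (comparison ⬝ L ⬝ S1 ⬝ B ⬝ u ⬝ f ⬝ Y ⬝ r ⬝ p ⬝ h)

/-- The type which says that `lensClaim` holds for every `m`, every delooping `(B, b, e)` of `ℤ_m`,
every pointed map `f : S¹ → B` that deloops the morphism `ℤ → ℤ_m`, and every `n`. (For `m = 0`
there is no equivalence `e`, as `zmod 0` is empty and a loop space is not.) -/
def lensPushout : Term :=
  pi nat fun m =>
  pi (U 0) fun B => pi B fun b => pi (isConnected B) fun _ =>
  pi (equiv 0 (zmod m) (Loop B b)) fun e => pi (isGroupHom m B b e) fun _ =>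
  pi (S1 ⇒ B) fun f => pi (eq 0 B (f ⬝ base) b) fun pf =>
  pi (deloopsQuotient m B b e f pf) fun _ =>
  pi nat fun n => lensClaim B f n

end HoTT

/-! The mathematical core is that joins are stable under base change: for `g : D → C`, the pullback
along `g` of the join of two types over `C` is the join over `D` of their pullbacks. Univalence
makes this almost definitional. A type over `C` equals the total space of the family of its fibers
(`totalFibers`), so it suffices to treat families `P`, `Q : C → U 0` (`overInd`). For families,
pullback along `g` is precomposition with `g` (`pullbackTotal`), and the join is the total space of
the fiberwise joins, the pushouts of `P c ← P c × Q c → Q c` (`joinTotal`). Forming these pushouts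
fiber by fiber commutes with precomposition by definition, which gives `joinPullback`. Induction on
`n`, starting from the fact that a type with a map to the empty type is empty, gives
`iterJoinPullback`; for the pullback of `f` along itself this is the equality of `Lⁿ ×_B S¹` and
`R^{*n}` as types over `S¹`.

For the square, `Lⁿ⁺¹` is by definition the pushout of the projections of `Lⁿ ×_B S¹`. Path
induction on the equality of types over `S¹` replaces `R^{*n}` by this pullback. The comparison map
then becomes the map from the join to itself given by the constructors, which is homotopic to the
identity (`joinSelfEquiv`, `squareClaim`).

The formal derivation is obtained by reflection. The terms are written with references to a library
of earlier definitions and verified by a type checker, `Library.check`, which is proved sound for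
`HasType` (`Sound.check`) and then evaluated on the whole library (`library_good`). Only soundness
is needed, so all recursions are bounded by fuel and may give up. Since `Conv` is untyped, a
computation step is justified without any typing. Neither confluence nor subject reduction is
proved: wherever subject reduction would guarantee that a computed type is well formed, the checker
checks that type again. -/

namespace HoTT

/-! ### Renaming and substitution of raw terms -/

namespace Raw

theorem liftRen_comp (ρ τ : ℕ → ℕ) : (liftRen τ ∘ liftRen ρ) = liftRen (τ ∘ ρ) := by
  funext n; cases n <;> rfl

theorem rename_rename (t : Raw) (ρ τ : ℕ → ℕ) : (t.rename ρ).rename τ = t.rename (τ ∘ ρ) := by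
  induction t generalizing ρ τ with
  | var | const | univ => rfl
  | pi A B hA hB => simp only [rename, hA, hB, liftRen_comp]
  | lam A t hA ht => simp only [rename, hA, ht, liftRen_comp]
  | app f a hf ha => simp only [rename, hf, ha]

theorem liftSubst_comp_liftRen (ρ : ℕ → ℕ) (σ : ℕ → Raw) :
    (liftSubst σ ∘ liftRen ρ) = liftSubst (σ ∘ ρ) := by
  funext n; cases n <;> rfl

theorem subst_rename (t : Raw) (ρ : ℕ → ℕ) (σ : ℕ → Raw) :
    (t.rename ρ).subst σ = t.subst (σ ∘ ρ) := by
  induction t generalizing ρ σ with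
  | var | const | univ => rfl
  | pi A B hA hB => simp only [rename, subst, hA, hB, liftSubst_comp_liftRen]
  | lam A t hA ht => simp only [rename, subst, hA, ht, liftSubst_comp_liftRen]
  | app f a hf ha => simp only [rename, subst, hf, ha]

theorem liftSubst_rename (σ : ℕ → Raw) (ρ : ℕ → ℕ) :
    (fun n => (liftSubst σ n).rename (liftRen ρ)) = liftSubst fun n => (σ n).rename ρ := by
  funext n
  cases n with
  | zero => rfl
  | succ n => simp only [liftSubst, rename_rename]; rfl

theorem rename_subst (t : Raw) (σ : ℕ → Raw) (ρ : ℕ → ℕ) :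
    (t.subst σ).rename ρ = t.subst fun n => (σ n).rename ρ := by
  induction t generalizing ρ σ with
  | var | const | univ => rfl
  | pi A B hA hB => simp only [rename, subst, hA, hB, liftSubst_rename]
  | lam A t hA ht => simp only [rename, subst, hA, ht, liftSubst_rename]
  | app f a hf ha => simp only [rename, subst, hf, ha]

theorem liftSubst_subst (σ τ : ℕ → Raw) :
    (fun n => (liftSubst σ n).subst (liftSubst τ)) = liftSubst fun n => (σ n).subst τ := by
  funext n
  cases n with
  | zero => rfl
  | succ n => simp only [liftSubst, subst_rename, rename_subst]; rfl

theorem subst_subst (t : Raw) (σ τ : ℕ → Raw) :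
    (t.subst σ).subst τ = t.subst fun n => (σ n).subst τ := by
  induction t generalizing σ τ with
  | var | const | univ => rfl
  | pi A B hA hB => simp only [subst, hA, hB, liftSubst_subst]
  | lam A t hA ht => simp only [subst, hA, ht, liftSubst_subst]
  | app f a hf ha => simp only [subst, hf, ha]

theorem liftSubst_var_comp (ρ : ℕ → ℕ) :
    liftSubst (fun n => var (ρ n)) = fun n => var (liftRen ρ n) := by
  funext n; cases n <;> rfl

theorem subst_var_comp (t : Raw) (ρ : ℕ → ℕ) : t.subst (fun n => var (ρ n)) = t.rename ρ := by
  induction t generalizing ρ with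
  | var | const | univ => rfl
  | pi A B hA hB => simp only [rename, subst, hA, hB, liftSubst_var_comp]
  | lam A t hA ht => simp only [rename, subst, hA, ht, liftSubst_var_comp]
  | app f a hf ha => simp only [rename, subst, hf, ha]

theorem liftRen_id : liftRen id = id := by
  funext n; cases n <;> rfl

theorem rename_id (t : Raw) : t.rename id = t := by
  induction t with
  | var | const | univ => rfl
  | pi A B hA hB => simp only [rename, hA, hB, liftRen_id]
  | lam A t hA ht => simp only [rename, hA, ht, liftRen_id]
  | app f a hf ha => simp only [rename, hf, ha]

theorem subst_var (t : Raw) : t.subst var = t := by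
  rw [show var = fun n => var (id n) from rfl, subst_var_comp, rename_id]

theorem inst_subst (t a : Raw) (σ : ℕ → Raw) :
    (t.inst a).subst σ = (t.subst (liftSubst σ)).inst (a.subst σ) := by
  simp only [inst, subst_subst]
  congr 1
  funext n
  cases n with
  | zero => rfl
  | succ n => simp only [liftSubst, subst_rename]; exact (subst_var _).symm

theorem inst_rename (t a : Raw) (ρ : ℕ → ℕ) :
    (t.inst a).rename ρ = (t.rename (liftRen ρ)).inst (a.rename ρ) := by
  simp only [← subst_var_comp, inst_subst, liftSubst_var_comp]

theorem rename_succ_inst (t a : Raw) : (t.rename Nat.succ).inst a = t := by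
  rw [inst, subst_rename]; exact subst_var t

theorem rename_succ_subst (t : Raw) (σ : ℕ → Raw) :
    (t.rename Nat.succ).subst (liftSubst σ) = (t.subst σ).rename Nat.succ := by
  rw [subst_rename, rename_subst]; rfl

/-- The left side is the body that results when an η-expanded abstraction is β-reduced under its
binder, as in `Conv.lam_domain`. -/
theorem rename_liftRen_succ_inst (t : Raw) :
    (t.rename (liftRen Nat.succ)).inst (var 0) = t := by
  rw [inst, subst_rename]
  conv_rhs => rw [← subst_var t]
  congr 1
  funext n; cases n <;> rfl

/-- All free variables of the term are below `n`. -/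
def ClosedAt : ℕ → Raw → Prop
  | n, var i => i < n
  | _, const _ => True
  | _, univ _ => True
  | n, pi A B => A.ClosedAt n ∧ B.ClosedAt (n + 1)
  | n, lam A t => A.ClosedAt n ∧ t.ClosedAt (n + 1)
  | n, app f a => f.ClosedAt n ∧ a.ClosedAt n
termination_by structural _ t => t

theorem ClosedAt.rename_eq {t : Raw} {n : ℕ} (h : t.ClosedAt n) {ρ : ℕ → ℕ}
    (hρ : ∀ i < n, ρ i = i) : t.rename ρ = t := by
  have lift : ∀ {n : ℕ} {ρ : ℕ → ℕ}, (∀ i < n, ρ i = i) → ∀ i < n + 1, liftRen ρ i = i := by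
    intro n ρ hρ i hi
    cases i with
    | zero => rfl
    | succ i => simp [liftRen, hρ i (by omega)]
  induction t generalizing n ρ with
  | var i => rw [rename, hρ i h]
  | const | univ => rfl
  | pi A B hA hB => rw [rename, hA h.1 hρ, hB h.2 (lift hρ)]
  | lam A t hA ht => rw [rename, hA h.1 hρ, ht h.2 (lift hρ)]
  | app f a hf ha => rw [rename, hf h.1 hρ, ha h.2 hρ]

theorem ClosedAt.subst_eq {t : Raw} {n : ℕ} (h : t.ClosedAt n) {σ : ℕ → Raw}
    (hσ : ∀ i < n, σ i = var i) : t.subst σ = t := by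
  have lift : ∀ {n : ℕ} {σ : ℕ → Raw}, (∀ i < n, σ i = var i) →
      ∀ i < n + 1, liftSubst σ i = var i := by
    intro n σ hσ i hi
    cases i with
    | zero => rfl
    | succ i => simp [liftSubst, hσ i (by omega), rename]
  induction t generalizing n σ with
  | var i => exact hσ i h
  | const | univ => rfl
  | pi A B hA hB => rw [subst, hA h.1 hσ, hB h.2 (lift hσ)]
  | lam A t hA ht => rw [subst, hA h.1 hσ, ht h.2 (lift hσ)]
  | app f a hf ha => rw [subst, hf h.1 hσ, ha h.2 hσ]

end Raw

/-! ### Stability of the judgments under renaming and substitution -/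

open Raw

theorem Comp.subst {s t : Raw} (h : Comp s t) (σ : ℕ → Raw) : Comp (s.subst σ) (t.subst σ) := by
  cases h <;> simp only [Raw.subst] <;> constructor

theorem Conv.subst {s t : Raw} (h : Conv s t) (σ : ℕ → Raw) : Conv (s.subst σ) (t.subst σ) := by
  induction h generalizing σ with
  | refl t => exact .refl _
  | symm _ ih => exact (ih σ).symm
  | trans _ _ ih₁ ih₂ => exact (ih₁ σ).trans (ih₂ σ)
  | pi _ _ ih₁ ih₂ => exact .pi (ih₁ σ) (ih₂ _)
  | lam _ _ ih₁ ih₂ => exact .lam (ih₁ σ) (ih₂ _)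
  | app _ _ ih₁ ih₂ => exact .app (ih₁ σ) (ih₂ σ)
  | beta A t a => rw [inst_subst]; exact .beta _ _ _
  | eta A t =>
    simp only [Raw.subst, rename_succ_subst]
    exact .eta _ _
  | comp h => exact .comp (h.subst σ)

theorem Conv.rename {s t : Raw} (h : Conv s t) (ρ : ℕ → ℕ) : Conv (s.rename ρ) (t.rename ρ) := by
  rw [← subst_var_comp, ← subst_var_comp]; exact h.subst _

/-- The domains of functions do not matter for definitional equality. -/
theorem Conv.lam_domain (A A' t : Raw) : Conv (.lam A t) (.lam A' t) := by
  -- The rule `η` lets the expansion of `λ (x : A'). t` carry any domain, here `A`; its body then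
  -- β-reduces to `t`.
  have h := (Conv.lam (.refl A) (Conv.beta (A'.rename Nat.succ) (t.rename (liftRen Nat.succ))
    (.var 0))).symm
  rw [rename_liftRen_succ_inst] at h
  exact h.trans (.eta A (.lam A' t))

/-- The types of the constants have no free variables, so the substitution computes away. Without
this the rule for constants would not be stable. -/
theorem Const.type_subst (c : Const) (σ : ℕ → Raw) : (c.type 0).subst σ = c.type 0 := by
  cases c <;> rfl

theorem Const.type_rename (c : Const) (ρ : ℕ → ℕ) : (c.type 0).rename ρ = c.type 0 := by
  rw [← subst_var_comp, type_subst]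

theorem HasType.rename {Γ : List Raw} {t A : Raw} (h : HasType Γ t A) {Δ : List Raw} {ρ : ℕ → ℕ}
    (hρ : ∀ n B, Γ[n]? = some B → ∃ C, Δ[ρ n]? = some C ∧
      C.rename (· + (ρ n + 1)) = (B.rename (· + (n + 1))).rename ρ) :
    HasType Δ (t.rename ρ) (A.rename ρ) := by
  have lift : ∀ {Γ Δ : List Raw} {ρ : ℕ → ℕ} (A : Raw),
      (∀ n B, Γ[n]? = some B → ∃ C, Δ[ρ n]? = some C ∧
        C.rename (· + (ρ n + 1)) = (B.rename (· + (n + 1))).rename ρ) →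
      ∀ n B, (A :: Γ)[n]? = some B → ∃ C, (A.rename ρ :: Δ)[liftRen ρ n]? = some C ∧
        C.rename (· + (liftRen ρ n + 1)) = (B.rename (· + (n + 1))).rename (liftRen ρ) := by
    intro Γ Δ ρ A hρ n B hn
    cases n with
    | zero =>
      obtain rfl : A = B := by simpa using hn
      refine ⟨A.rename ρ, rfl, ?_⟩
      simp only [rename_rename]; rfl
    | succ n =>
      obtain ⟨C, hC, e⟩ := hρ n B (by simpa using hn)
      refine ⟨C, by simpa [liftRen] using hC, ?_⟩
      have := congrArg (Raw.rename · Nat.succ) e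
      simp only [rename_rename] at this ⊢
      exact this
  induction h generalizing Δ ρ with
  | var hn =>
    obtain ⟨C, hC, e⟩ := hρ _ _ hn
    rw [← e]; exact .var hC
  | const Γ c => rw [Const.type_rename]; exact .const Δ c
  | univ Γ i => exact .univ Δ i
  | cumul _ ih => exact .cumul (ih hρ)
  | pi _ _ ih₁ ih₂ => exact .pi (ih₁ hρ) (ih₂ (lift _ hρ))
  | lam _ _ ih₁ ih₂ => exact .lam (ih₁ hρ) (ih₂ (lift _ hρ))
  | app _ _ ih₁ ih₂ =>
    rw [inst_rename]
    exact .app (ih₁ hρ) (ih₂ hρ)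
  | conv _ hc _ ih₁ ih₂ => exact .conv (ih₁ hρ) (hc.rename ρ) (ih₂ hρ)

theorem HasType.weaken {Γ : List Raw} {t A : Raw} (h : HasType Γ t A) (B : Raw) :
    HasType (B :: Γ) (t.rename Nat.succ) (A.rename Nat.succ) :=
  h.rename fun n C hn => ⟨C, by simpa using hn, by simp only [rename_rename]; rfl⟩

theorem HasType.subst {Γ : List Raw} {t A : Raw} (h : HasType Γ t A) {Δ : List Raw} {σ : ℕ → Raw}
    (hσ : ∀ n B, Γ[n]? = some B → HasType Δ (σ n) ((B.rename (· + (n + 1))).subst σ)) :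
    HasType Δ (t.subst σ) (A.subst σ) := by
  have lift : ∀ {Γ Δ : List Raw} {σ : ℕ → Raw} (A : Raw),
      (∀ n B, Γ[n]? = some B → HasType Δ (σ n) ((B.rename (· + (n + 1))).subst σ)) →
      ∀ n B, (A :: Γ)[n]? = some B → HasType (A.subst σ :: Δ) (liftSubst σ n)
        ((B.rename (· + (n + 1))).subst (liftSubst σ)) := by
    intro Γ Δ σ A hσ n B hn
    cases n with
    | zero =>
      obtain rfl : A = B := by simpa using hn
      rw [show (fun x => x + (0 + 1)) = Nat.succ from rfl, rename_succ_subst]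
      exact .var (n := 0) rfl
    | succ n =>
      have := (hσ n B (by simpa using hn)).weaken (A.subst σ)
      rw [← rename_succ_subst, rename_rename] at this
      exact this
  induction h generalizing Δ σ with
  | var hn => exact hσ _ _ hn
  | const Γ c => rw [Const.type_subst]; exact .const Δ c
  | univ Γ i => exact .univ Δ i
  | cumul _ ih => exact .cumul (ih hσ)
  | pi _ _ ih₁ ih₂ => exact .pi (ih₁ hσ) (ih₂ (lift _ hσ))
  | lam _ _ ih₁ ih₂ => exact .lam (ih₁ hσ) (ih₂ (lift _ hσ))
  | app _ _ ih₁ ih₂ => rw [inst_subst]; exact .app (ih₁ hσ) (ih₂ hσ)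
  | conv _ hc _ ih₁ ih₂ => exact .conv (ih₁ hσ) (hc.subst σ) (ih₂ hσ)

/-- In the empty context this shows that library entries denote closed terms, so that unfolding them
commutes with lifting and substitution. -/
theorem HasType.closedAt {Γ : List Raw} {t A : Raw} (h : HasType Γ t A) :
    t.ClosedAt Γ.length := by
  induction h with
  | var hn => exact (List.getElem?_eq_some_iff.1 hn).1
  | const | univ => trivial
  | cumul _ ih => exact ih
  | pi _ _ ih₁ ih₂ => exact ⟨ih₁, ih₂⟩
  | lam _ _ ih₁ ih₂ => exact ⟨ih₁, ih₂⟩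
  | app _ _ ih₁ ih₂ => exact ⟨ih₁, ih₂⟩
  | conv _ _ _ ih₁ _ => exact ih₁

/-! ### Types, contexts and inversion -/

/-- `A` is a type in the context `Γ`. -/
def IsType (Γ : List Raw) (A : Raw) : Prop := ∃ i, HasType Γ A (.univ i)

/-- All entries of the context are types. -/
def WfCtx (Γ : List Raw) : Prop :=
  ∀ (n : ℕ) (A : Raw), Γ[n]? = some A → IsType Γ (A.rename (· + (n + 1)))

theorem HasType.univ_le {Γ : List Raw} {A : Raw} {i j : ℕ} (h : HasType Γ A (.univ i))
    (hij : i ≤ j) : HasType Γ A (.univ j) := by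
  induction hij with
  | refl => exact h
  | step _ ih => exact ih.cumul

theorem IsType.pi {Γ : List Raw} {A B : Raw} (hA : IsType Γ A) (hB : IsType (A :: Γ) B) :
    IsType Γ (.pi A B) := by
  obtain ⟨i, hA⟩ := hA
  obtain ⟨j, hB⟩ := hB
  exact ⟨max i j, .pi (hA.univ_le (le_max_left i j)) (hB.univ_le (le_max_right i j))⟩

/-- Only the rules `pi`, `cumul` and `conv` can end such a derivation, and the last two keep the
subject. This inversion on the subject is all that the checker needs; injectivity of `Π` under
conversion, which rests on confluence, is avoided. -/
theorem HasType.pi_inv {Γ : List Raw} {A B T : Raw} (h : HasType Γ (.pi A B) T) :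
    IsType Γ A ∧ IsType (A :: Γ) B := by
  generalize hs : Raw.pi A B = s at h
  induction h with
  | pi hA hB =>
    obtain ⟨rfl, rfl⟩ : _ ∧ _ := by simpa using hs
    exact ⟨⟨_, hA⟩, ⟨_, hB⟩⟩
  | cumul _ ih => exact ih hs
  | conv _ _ _ ih _ => exact ih hs
  | var | const | univ | lam | app => cases hs

theorem WfCtx.nil : WfCtx [] := fun n A h => by simp at h

theorem WfCtx.cons {Γ : List Raw} {A : Raw} (hΓ : WfCtx Γ) (hA : IsType Γ A) :
    WfCtx (A :: Γ) := by
  intro n B hn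
  cases n with
  | zero =>
    obtain rfl : A = B := by simpa using hn
    exact hA.imp fun i h => h.weaken A
  | succ n =>
    obtain ⟨i, h⟩ := hΓ n B (by simpa using hn)
    have := h.weaken A
    rw [rename_rename] at this
    exact ⟨i, this⟩

theorem HasType.inst {Γ : List Raw} {A t B a : Raw} (h : HasType (A :: Γ) t B)
    (ha : HasType Γ a A) : HasType Γ (t.inst a) (B.inst a) := by
  refine h.subst fun n C hn => ?_
  cases n with
  | zero =>
    obtain rfl : A = C := by simpa using hn
    have := rename_succ_inst A a
    rw [Raw.inst] at this
    rw [show (fun x => x + (0 + 1)) = Nat.succ from rfl, this]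
    exact ha
  | succ n =>
    have := HasType.var (Γ := Γ) (n := n) (A := C) (by simpa using hn)
    rw [subst_rename]
    rwa [← subst_var_comp] at this

/-- The identity substitution is well typed between the two contexts: the variable `0` of type `A'`
is converted to type `A`. -/
theorem HasType.conv_ctx {Γ : List Raw} {A A' t B : Raw} (h : HasType (A :: Γ) t B)
    (hc : Conv A' A) (hA : IsType Γ A) : HasType (A' :: Γ) t B := by
  rw [← subst_var t, ← subst_var B]
  refine h.subst fun n C hn => ?_
  cases n with
  | zero =>
    obtain rfl : A = C := by simpa using hn
    obtain ⟨i, hA⟩ := hA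
    rw [subst_var]
    exact (HasType.var (n := 0) (A := A') rfl).conv (hc.rename _) (hA.weaken A')
  | succ n => rw [subst_var]; exact .var (by simpa using hn)

theorem HasType.of_closed {t A : Raw} (h : HasType [] t A) (Γ : List Raw) : HasType Γ t A := by
  have := h.rename (Δ := Γ) (ρ := id) (fun n B hn => by simp at hn)
  rwa [rename_id, rename_id] at this

/-! ### Terms with references to a library of definitions, and a type checker for them -/

/-- Raw terms with references `ref k` to the entries of a library. -/
inductive Tm : Type
  | var (n : ℕ)
  | const (c : Const)
  | univ (i : ℕ)
  | pi (A B : Tm)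
  | lam (A t : Tm)
  | app (f a : Tm)
  | ref (k : ℕ)

/-- A number that determines the primitive constant. -/
def Const.code : Const → ℕ × ℕ × ℕ
  | sigma i => (0, i, 0) | pair i => (1, i, 0) | sigmaInd i j => (2, i, j)
  | empty => (3, 0, 0) | emptyInd j => (4, 0, j)
  | nat => (5, 0, 0) | zero => (6, 0, 0) | succ => (7, 0, 0) | natInd j => (8, 0, j)
  | eq i => (9, i, 0) | refl i => (10, i, 0) | eqInd i j => (11, i, j)
  | circle => (12, 0, 0) | base => (13, 0, 0) | loop => (14, 0, 0)
  | circleInd j => (15, 0, j) | circleLoop j => (16, 0, j)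
  | pushout i => (17, i, 0) | inl i => (18, i, 0) | inr i => (19, i, 0) | glue i => (20, i, 0)
  | pushoutInd i j => (21, i, j) | pushoutGlue i j => (22, i, j)
  | trunc i => (23, i, 0) | truncMk i => (24, i, 0) | truncSet i => (25, i, 0)
  | truncInd i j => (26, i, j)
  | funext i => (27, i, 0) | univalence i => (28, i, 0)

theorem Const.code_injective {c d : Const} (h : c.code = d.code) : c = d := by
  cases c <;> cases d <;> simp_all [Const.code]

/-- Equality of primitive constants. -/
def Const.beq (c d : Const) : Bool :=
  Nat.beq c.code.1 d.code.1 && (Nat.beq c.code.2.1 d.code.2.1 && Nat.beq c.code.2.2 d.code.2.2)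

theorem Const.eq_of_beq {c d : Const} (h : c.beq d = true) : c = d := by
  simp only [beq, Bool.and_eq_true] at h
  exact code_injective (Prod.ext (Nat.eq_of_beq_eq_true h.1)
    (Prod.ext (Nat.eq_of_beq_eq_true h.2.1) (Nat.eq_of_beq_eq_true h.2.2)))

namespace Tm

/-- The raw term that is obtained by unfolding the references. -/
def expand (δ : ℕ → Raw) : Tm → Raw
  | var n => .var n
  | const c => .const c
  | univ i => .univ i
  | pi A B => .pi (A.expand δ) (B.expand δ)
  | lam A t => .lam (A.expand δ) (t.expand δ)
  | app f a => .app (f.expand δ) (a.expand δ)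
  | ref k => δ k

/-- Increase the variables from `c` on by `n`. -/
def lift (n : ℕ) : Tm → ℕ → Tm
  | var i, c => bif Nat.blt i c then var i else var (Nat.add i n)
  | const c, _ => const c
  | univ i, _ => univ i
  | pi A B, c => pi (A.lift n c) (B.lift n (Nat.succ c))
  | lam A t, c => lam (A.lift n c) (t.lift n (Nat.succ c))
  | app f a, c => app (f.lift n c) (a.lift n c)
  | ref k, _ => ref k

/-- Substitute the terms in `σ` for the variables from `k` on and lower the variables above. -/
def subst : Tm → List Tm → ℕ → Tm
  | var i, σ, k => bif Nat.blt i k then var i else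
      match σ[Nat.sub i k]? with
      | some a => bif Nat.beq k 0 then a else a.lift k 0
      | none => var (Nat.sub i σ.length)
  | const c, _, _ => const c
  | univ i, _, _ => univ i
  | pi A B, σ, k => pi (A.subst σ k) (B.subst σ (Nat.succ k))
  | lam A t, σ, k => lam (A.subst σ k) (t.subst σ (Nat.succ k))
  | app f b, σ, k => app (f.subst σ k) (b.subst σ k)
  | ref k, _, _ => ref k

/-- Substitute the terms in `σ` for the variables from `0` on. -/
def close (t : Tm) : List Tm → Tm
  | [] => t
  | a :: σ => t.subst (a :: σ) 0

/-- Application to a list of arguments. -/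
def apps : Tm → List Tm → Tm
  | t, [] => t
  | t, a :: s => (app t a).apps s

/-- The head and the arguments of an iterated application. -/
def spine : Tm → List Tm → Tm × List Tm
  | app f a, s => f.spine (a :: s)
  | t, s => (t, s)

/-- All references satisfy `p`. -/
def refsAll (p : ℕ → Bool) : Tm → Bool
  | pi A B => A.refsAll p && B.refsAll p
  | lam A t => A.refsAll p && t.refsAll p
  | app f a => f.refsAll p && a.refsAll p
  | ref k => p k
  | _ => true

end Tm

/-- The number of arguments of an eliminator before the one that it examines. -/
def Const.major : Const → Option ℕ
  | sigmaInd _ _ => some 4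
  | natInd _ => some 3
  | eqInd _ _ => some 5
  | circleInd _ => some 3
  | pushoutInd _ _ => some 9
  | truncInd _ _ => some 4
  | _ => none

/-- The computation rules: the eliminator `c` with arguments `s` examines `c' s'`. -/
def iota : Const → List Tm → Const → List Tm → Option (Tm × List Tm)
  | .sigmaInd _ _, _ :: _ :: _ :: t :: _ :: s, .pair _, [_, _, a, b] => some (t, a :: b :: s)
  | .natInd _, _ :: z :: _ :: _ :: s, .zero, [] => some (z, s)
  | .natInd j, C :: z :: t :: _ :: s, .succ, [n] =>
      some (t, n :: (Tm.const (.natInd j)).apps [C, z, t, n] :: s)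
  | .eqInd _ _, _ :: _ :: _ :: c :: _ :: _ :: s, .refl _, [_, _] => some (c, s)
  | .circleInd _, _ :: b :: _ :: _ :: s, .base, [] => some (b, s)
  | .pushoutInd _ _, _ :: _ :: _ :: _ :: _ :: _ :: l :: _ :: _ :: _ :: s, .inl _,
      [_, _, _, _, _, a] => some (l, a :: s)
  | .pushoutInd _ _, _ :: _ :: _ :: _ :: _ :: _ :: _ :: r :: _ :: _ :: s, .inr _,
      [_, _, _, _, _, b] => some (r, b :: s)
  | .truncInd _ _, _ :: _ :: _ :: t :: _ :: s, .truncMk _, [_, a] => some (t, a :: s)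
  | _, _, _, _ => none

/-- A library: a list of definitions `(k, body, type)`. -/
abbrev Library : Type := List (ℕ × Tm × Tm)

namespace Library

def lookup : Library → ℕ → Option (Tm × Tm)
  | [], _ => none
  | (k, d) :: E, n => bif Nat.beq n k then some d else lookup E n

/-- The raw terms that the references stand for. -/
def den : Library → ℕ → Raw
  | [], _ => .const .empty
  | (k, d) :: E, n => bif Nat.beq n k then d.1.expand (den E) else den E n

/-- Weak head normal form of `t[σ] s`, as a head with a list of arguments. -/
def whnf (E : Library) : ℕ → Tm → List Tm → List Tm → Tm × List Tm
  -- Without fuel the term is returned unreduced, which is still convertible to the input.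
  | 0, t, σ, s => (t.close σ, s)
  | N + 1, t, σ, s =>
    match t with
    -- Arguments are closed when they are pushed on the stack, so the environment concerns only the
    -- head.
    | .app f a => E.whnf N f σ (a.close σ :: s)
    | .lam A b =>
      match s with
      | a :: s => E.whnf N b (a :: σ) s
      | [] => ((Tm.lam A b).close σ, [])
    | .var i =>
      match σ[i]? with
      | some a => E.whnf N a [] s
      | none => (.var (Nat.sub i σ.length), s)
    | .ref k =>
      match E.lookup k with
      | some d => E.whnf N d.1 [] s
      | none => (.ref k, s)
    | .const c =>
      match c.major with
      | some n =>
        match s[n]? with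
        | some z =>
          match E.whnf N z [] [] with
          | (.const c', s') =>
            match iota c s c' s' with
            | some (h, s'') => E.whnf N h [] s''
            | none => (.const c, s)
          | _ => (.const c, s)
        | none => (.const c, s)
      | none => (.const c, s)
    | .univ i => (.univ i, s)
    | .pi A B => ((Tm.pi A B).close σ, s)

/-- Comparison of two lists of arguments. -/
def all₂ (r : Tm → Tm → Bool) : List Tm → List Tm → Bool
  | [], [] => true
  | a :: s, b :: t => r a b && all₂ r s t
  | _, _ => false

/-- Comparison of two terms with equal heads, given a comparison of their parts. -/
def cmp (r : Tm → Tm → Bool) : Tm × List Tm → Tm × List Tm → Bool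
  | (.var i, s), (.var j, t) => Nat.beq i j && all₂ r s t
  | (.const c, s), (.const d, t) => c.beq d && all₂ r s t
  | (.univ i, s), (.univ j, t) => Nat.beq i j && all₂ r s t
  | (.ref i, s), (.ref j, t) => Nat.beq i j && all₂ r s t
  | (.pi A B, s), (.pi A' B', t) => (r A A' && r B B') && all₂ r s t
  -- Domains need no comparison, by `Conv.lam_domain`.
  | (.lam _ b, s), (.lam _ b', t) => r b b' && all₂ r s t
  | _, _ => false

/-- Comparison with functions by the rule `η`. -/
def cmpEta (r : Tm → Tm → Bool) : Tm × List Tm → Tm × List Tm → Bool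
  | (.lam _ b, []), (h, t) => r b (.app ((h.apps t).lift 1 0) (.var 0))
  | (h, s), (.lam _ b, []) => r (.app ((h.apps s).lift 1 0) (.var 0)) b
  | _, _ => false

/-- A test for definitional equality; `W` bounds the computation of head normal forms. -/
def conv (E : Library) (W : ℕ) : ℕ → Tm → Tm → Bool
  | 0, _, _ => false
  | N + 1, s, t =>
    -- Terms with the same head are compared argument by argument before any definition is unfolded.
    cmp (E.conv W N) (s.spine []) (t.spine []) ||
      (let s' := E.whnf W s [] []
       let t' := E.whnf W t [] []
       cmp (E.conv W N) s' t' || cmpEta (E.conv W N) s' t')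

/-- Test whether a type with head normal form `A` is a subtype of one with `B`. -/
def cumul : Tm × List Tm → Tm × List Tm → Bool
  | (.univ i, []), (.univ j, []) => Nat.ble i j
  | _, _ => false

/-- The level of the universe `T[σ]`, up to definitional equality. -/
def univOf (E : Library) (N : ℕ) (T : Tm × List Tm) : Option ℕ :=
  match E.whnf N T.1 T.2 [] with
  | (.univ i, []) => some i
  | _ => none

/-- `A`, `B` and `τ` such that `T[σ]` is `(Π A. B)[τ]`, up to definitional equality; the flag tells
whether `T` has this form without computation. -/
def piOf (E : Library) (N : ℕ) : Tm × List Tm → Option (Tm × Tm × List Tm × Bool)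
  | (.pi A B, σ) => some (A, B, σ, true)
  | (T, σ) =>
    match E.whnf N T σ [] with
    | (.pi A B, []) => some (A, B, [], false)
    | _ => none

/-- Inference of the type of `t` (if `T` is `none`) and test whether `t` has the type `T`. The
result `(S, σ)` means that `t` has the type `S[σ]`. -/
def check (E : Library) (W : ℕ) : ℕ → List Tm → Tm → Option Tm → Option (Tm × List Tm)
  | 0, _, _, _ => none
  | N + 1, Γ, t, none =>
    match t with
    | .var n => Γ[n]?.map fun A => (A.lift (n + 1) 0, [])
    -- A primitive constant is admitted only as the body of a library entry, where `admits` compares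
    -- its type; elsewhere it occurs as a reference.
    | .const _ => none
    | .univ i => some (.univ (i + 1), [])
    | .ref k => (E.lookup k).map fun d => (d.2, [])
    | .pi A B => do
      let i ← E.univOf W (← E.check W N Γ A none)
      let j ← E.univOf W (← E.check W N (A :: Γ) B none)
      some (.univ (Nat.max i j), [])
    | .lam A t => do
      let _ ← E.univOf W (← E.check W N Γ A none)
      let B ← E.check W N (A :: Γ) t none
      some (.pi A (B.1.close B.2), [])
    | .app f a => do
      let F ← E.check W N Γ f none
      let (A, B, σ, b) ← E.piOf W F
      -- A product type found by computation is not known to be well formed, so it is checked again.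
      let _ ← bif b then some F else E.check W N Γ ((Tm.pi A B).close σ) none
      let _ ← E.check W N Γ a (some (A.close σ))
      some (B, a :: σ)
  | N + 1, Γ, t, some T =>
    let sub : Unit → Option (Tm × List Tm) := fun _ => do
      let S ← E.check W N Γ t none
      let S' := S.1.close S.2
      bif E.conv W W S' T || cumul (E.whnf W S' [] []) (E.whnf W T [] []) then some (T, []) else none
    match t with
    | .lam A t =>
      match E.piOf W (T, []) with
      -- The environment returned here is empty, because `T` comes with the empty one; see the last
      -- clause of `Sound.piOf`.
      | some (A', B', _, b) => do
        let _ ← E.univOf W (← E.check W N Γ A none)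
        let _ ← bif b then some (T, []) else E.check W N Γ (.pi A' B') none
        bif E.conv W W A A' then do
          let _ ← E.check W N (A :: Γ) t (some B')
          some (T, [])
        else none
      | none => none
    | _ => sub ()

end Library

/-! ### Unfolding of references commutes with the syntactic operations -/

open Raw

namespace Tm

/-- Lifting leaves references alone, which agrees with renaming after expansion because references
stand for closed terms. -/
theorem expand_lift {δ : ℕ → Raw} (hδ : ∀ k, (δ k).ClosedAt 0) (n : ℕ) (t : Tm) (c : ℕ) :
    (t.lift n c).expand δ = (t.expand δ).rename fun i => if i < c then i else i + n := by
  have hl : ∀ c, liftRen (fun i => if i < c then i else i + n) =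
      fun i => if i < c + 1 then i else i + n := by
    intro c; funext i
    cases i with
    | zero => simp [liftRen]
    | succ i => simp only [liftRen, Nat.add_lt_add_iff_right]; split <;> omega
  induction t generalizing c with
  | var i =>
    simp only [lift, expand, Raw.rename]
    by_cases h : i < c
    · simp [show Nat.blt i c = true from Nat.blt_eq.symm ▸ h, h, expand]
    · have : Nat.blt i c = false := Bool.eq_false_iff.2 (mt (fun e => Nat.blt_eq ▸ e) h)
      simp [this, h, expand]
  | const | univ => rfl
  | pi A B hA hB => simp only [lift, expand, Raw.rename, hA, hB, hl, Nat.succ_eq_add_one]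
  | lam A t hA ht => simp only [lift, expand, Raw.rename, hA, ht, hl, Nat.succ_eq_add_one]
  | app f a hf ha => simp only [lift, expand, Raw.rename, hf, ha]
  | ref k => exact ((hδ k).rename_eq (by simp)).symm

theorem expand_lift_zero {δ : ℕ → Raw} (hδ : ∀ k, (δ k).ClosedAt 0) (n : ℕ) (t : Tm) :
    (t.lift n 0).expand δ = (t.expand δ).rename (· + n) := by
  simp [expand_lift hδ]

/-- The substitution of raw terms that corresponds to `Tm.subst`. -/
def rawSubst (δ : ℕ → Raw) (σ : List Tm) (k : ℕ) : ℕ → Raw := fun i =>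
  if i < k then .var i else
    match σ[i - k]? with
    | some a => (a.expand δ).rename (· + k)
    | none => .var (i - σ.length)

theorem liftSubst_rawSubst (δ : ℕ → Raw) (σ : List Tm) (k : ℕ) :
    liftSubst (rawSubst δ σ k) = rawSubst δ σ (k + 1) := by
  funext i
  cases i with
  | zero => simp [liftSubst, rawSubst]
  | succ i =>
    simp only [liftSubst, rawSubst, Nat.add_lt_add_iff_right, Nat.add_sub_add_right]
    split
    · rfl
    · cases h : σ[i - k]? with
      | some a => simp only [rename_rename]; rfl
      | none =>
        have := List.getElem?_eq_none_iff.1 h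
        simp only [Raw.rename]
        congr 1
        omega

theorem expand_subst {δ : ℕ → Raw} (hδ : ∀ k, (δ k).ClosedAt 0) (t : Tm) (σ : List Tm) (k : ℕ) :
    (t.subst σ k).expand δ = (t.expand δ).subst (rawSubst δ σ k) := by
  induction t generalizing k with
  | var i =>
    simp only [subst, expand, Raw.subst, rawSubst]
    by_cases h : i < k
    · simp [show Nat.blt i k = true from Nat.blt_eq.symm ▸ h, h, expand]
    · have h' : Nat.blt i k = false := Bool.eq_false_iff.2 (mt (fun e => Nat.blt_eq ▸ e) h)
      simp only [h', h, cond_false, if_false, Nat.sub_eq]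
      cases σ[i - k]? with
      | none => rfl
      | some a =>
        cases k with
        | zero => exact (rename_id _).symm
        | succ k => exact expand_lift_zero hδ _ _
  | const | univ => rfl
  | pi A B hA hB => simp only [subst, expand, Raw.subst, hA, hB, liftSubst_rawSubst,
      Nat.succ_eq_add_one]
  | lam A t hA ht => simp only [subst, expand, Raw.subst, hA, ht, liftSubst_rawSubst,
      Nat.succ_eq_add_one]
  | app f a hf ha => simp only [subst, expand, Raw.subst, hf, ha]
  | ref j => exact ((hδ j).subst_eq fun i hi => absurd hi i.not_lt_zero).symm

theorem rawSubst_nil (δ : ℕ → Raw) : rawSubst δ [] 0 = .var := by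
  funext i; simp [rawSubst]

theorem expand_close {δ : ℕ → Raw} (hδ : ∀ k, (δ k).ClosedAt 0) (t : Tm) (σ : List Tm) :
    (t.close σ).expand δ = (t.expand δ).subst (rawSubst δ σ 0) := by
  cases σ with
  | nil => rw [rawSubst_nil, subst_var]; rfl
  | cons a σ => exact expand_subst hδ _ _ _

/-- An environment extended by one argument acts as the old environment under a binder followed by
one instantiation. This is the form needed for a β-step of `whnf` and for the result type of an
application. -/
theorem rawSubst_cons (δ : ℕ → Raw) (a : Tm) (σ : List Tm) (t : Raw) :
    t.subst (rawSubst δ (a :: σ) 0) = (t.subst (rawSubst δ σ 1)).inst (a.expand δ) := by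
  rw [← liftSubst_rawSubst, inst, subst_subst]
  congr 1
  funext i
  cases i with
  | zero => exact rename_id _
  | succ i =>
    have h := rename_succ_inst (rawSubst δ σ 0 i) (a.expand δ)
    rw [inst] at h
    rw [liftSubst, h]
    simp only [rawSubst, Nat.not_lt_zero, if_false, Nat.sub_zero, List.getElem?_cons_succ,
      List.length_cons, Nat.add_sub_add_right]

/-- With `p` the test for being an entry of the old library, this keeps old expansions unchanged
when an entry is added. -/
theorem expand_congr {δ δ' : ℕ → Raw} {p : ℕ → Bool} (h : ∀ k, p k = true → δ k = δ' k) {t : Tm}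
    (ht : t.refsAll p = true) : t.expand δ = t.expand δ' := by
  induction t with
  | var | const | univ => rfl
  | pi A B hA hB =>
    simp only [refsAll, Bool.and_eq_true] at ht; rw [expand, expand, hA ht.1, hB ht.2]
  | lam A t hA hB =>
    simp only [refsAll, Bool.and_eq_true] at ht; rw [expand, expand, hA ht.1, hB ht.2]
  | app A t hA hB =>
    simp only [refsAll, Bool.and_eq_true] at ht; rw [expand, expand, hA ht.1, hB ht.2]
  | ref k => exact h k ht

theorem refsAll_mono {p q : ℕ → Bool} (h : ∀ k, p k = true → q k = true) {t : Tm}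
    (ht : t.refsAll p = true) : t.refsAll q = true := by
  induction t with
  | var | const | univ => rfl
  | pi A B hA hB =>
    simp only [refsAll, Bool.and_eq_true] at ht ⊢; exact ⟨hA ht.1, hB ht.2⟩
  | lam A t hA hB =>
    simp only [refsAll, Bool.and_eq_true] at ht ⊢; exact ⟨hA ht.1, hB ht.2⟩
  | app A t hA hB =>
    simp only [refsAll, Bool.and_eq_true] at ht ⊢; exact ⟨hA ht.1, hB ht.2⟩
  | ref k => exact h k ht

/-- Definitional equality of the expanded terms. -/
def Equal (δ : ℕ → Raw) (s t : Tm) : Prop := Conv (s.expand δ) (t.expand δ)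

theorem Equal.rfl' {δ : ℕ → Raw} {t : Tm} : Equal δ t t := .refl _

theorem Equal.apps {δ : ℕ → Raw} {s t : Tm} (h : Equal δ s t) :
    ∀ {l l' : List Tm}, List.Forall₂ (Equal δ) l l' → Equal δ (s.apps l) (t.apps l')
  | _, _, .nil => h
  | _, _, .cons ha hl => Equal.apps (s := .app _ _) (t := .app _ _) (Conv.app h ha) hl

theorem Equal.apps_left {δ : ℕ → Raw} {s t : Tm} (h : Equal δ s t) (l : List Tm) :
    Equal δ (s.apps l) (t.apps l) :=
  h.apps (List.forall₂_same.2 fun _ _ => .rfl')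

theorem apps_spine (t : Tm) (s : List Tm) : (t.spine s).1.apps (t.spine s).2 = t.apps s := by
  induction t generalizing s with
  | app f a hf ha => exact hf (a :: s)
  | _ => rfl

end Tm

open Tm

/-- The examined argument `z` is only convertible to a constructor; congruence replaces it, and then
a rule of `Comp` applies. These rules do not compare the parameters of the constructor with those of
the eliminator. -/
theorem iota_equal {δ : ℕ → Raw} {c c' : Const} {s s' t : List Tm} {h : Tm}
    (e : iota c s c' s' = some (h, t)) {n : ℕ} (hn : c.major = some n) {z : Tm}
    (hz : s[n]? = some z) (hc : Equal δ z ((Tm.const c').apps s')) :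
    Equal δ ((Tm.const c).apps s) (h.apps t) := by
  unfold iota at e
  split at e
  all_goals first
    | (cases e; done)
    | (simp only [Option.some.injEq, Prod.mk.injEq] at e
       obtain ⟨rfl, rfl⟩ := e
       simp only [Const.major, Option.some.injEq] at hn
       subst hn
       simp only [List.getElem?_cons_succ, List.getElem?_cons_zero, Option.some.injEq] at hz
       subst hz
       simp only [Tm.apps]
       refine Equal.apps_left ?_ _
       exact (Conv.app (.refl _) hc).trans (.comp (by constructor)))

/-! ### Soundness of the type checker -/

namespace Library

/-- The definitions of the library are well typed, if references stand for `δ`. -/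
structure Sound (E : Library) (δ : ℕ → Raw) : Prop where
  closed : ∀ k, (δ k).ClosedAt 0
  unfold : ∀ k d, E.lookup k = some d → δ k = d.1.expand δ
  hasType : ∀ k d, E.lookup k = some d → HasType [] (δ k) (d.2.expand δ)
  isType : ∀ k d, E.lookup k = some d → IsType [] (d.2.expand δ)

variable {E : Library} {δ : ℕ → Raw}

/-- Each step of the machine is a β-step, an unfolding or a computation rule, hence a conversion. No
typing hypothesis enters, since `Conv` is untyped. -/
theorem Sound.whnf (hE : E.Sound δ) (N : ℕ) (t : Tm) (σ s : List Tm) :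
    Equal δ ((t.close σ).apps s) ((E.whnf N t σ s).1.apps (E.whnf N t σ s).2) := by
  induction N generalizing t σ s with
  | zero => exact .rfl'
  | succ N ih =>
    cases t with
    | univ => cases σ <;> exact .rfl'
    | pi => exact .rfl'
    | app f a =>
      refine Conv.trans (Equal.apps_left (s := (Tm.app f a).close σ) (t := .app (f.close σ) (a.close σ))
        ?_ s) (ih f σ (a.close σ :: s))
      rw [Equal, expand, expand_close hE.closed, expand_close hE.closed, expand_close hE.closed]
      exact .refl _
    | lam A b =>
      cases s with
      | nil => exact .rfl'
      | cons a s =>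
        refine Conv.trans (Equal.apps_left (s := .app ((Tm.lam A b).close σ) a)
          (t := b.close (a :: σ)) ?_ s) (ih _ _ _)
        rw [Equal, expand, expand_close hE.closed, expand_close hE.closed, rawSubst_cons,
          ← liftSubst_rawSubst]
        exact .beta _ _ _
    | var i =>
      have h : ((Tm.var i).close σ).expand δ = rawSubst δ σ 0 i := expand_close hE.closed _ _
      simp only [rawSubst, Nat.not_lt_zero, if_false, Nat.sub_zero] at h
      simp only [Library.whnf]
      cases hi : σ[i]? with
      | some a =>
        refine Conv.trans (Equal.apps_left (t := a) ?_ s) (ih a [] s)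
        rw [Equal, h, hi]
        exact (rename_id (a.expand δ)) ▸ .refl _
      | none =>
        refine Equal.apps_left ?_ s
        rw [Equal, h, hi]
        exact .refl _
    | ref k =>
      have h : ((Tm.ref k).close σ).expand δ = δ k :=
        (expand_close hE.closed _ _).trans
          ((hE.closed k).subst_eq fun i hi => absurd hi i.not_lt_zero)
      simp only [Library.whnf]
      split
      · next d hd =>
        refine Conv.trans (Equal.apps_left (t := d.1) ?_ s) (ih d.1 [] s)
        rw [Equal, h, hE.unfold k d hd]
        exact .refl _
      · refine Equal.apps_left ?_ s
        rw [Equal, h]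
        exact .refl _
    | const c =>
      have h : (Tm.const c).close σ = .const c := by cases σ <;> rfl
      rw [h]
      simp only [Library.whnf]
      split
      · next n hn =>
        split
        · next z hz =>
          split
          · next c' s' hc =>
            split
            · next h t e =>
              refine Conv.trans (iota_equal e hn hz ?_) (ih h [] t)
              have := ih z [] []
              rwa [hc] at this
            · exact .rfl'
          · exact .rfl'
        · exact .rfl'
      · exact .rfl'

theorem all₂_sound {r : Tm → Tm → Bool} (hr : ∀ s t, r s t = true → Equal δ s t) :
    ∀ {s t : List Tm}, all₂ r s t = true → List.Forall₂ (Equal δ) s t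
  | [], [], _ => .nil
  | a :: s, b :: t, h => by
    simp only [all₂, Bool.and_eq_true] at h
    exact .cons (hr _ _ h.1) (all₂_sound hr h.2)
  | [], _ :: _, h => by simp [all₂] at h
  | _ :: _, [], h => by simp [all₂] at h

theorem cmp_sound {r : Tm → Tm → Bool} (hr : ∀ s t, r s t = true → Equal δ s t)
    {s t : Tm × List Tm} (h : cmp r s t = true) : Equal δ (s.1.apps s.2) (t.1.apps t.2) := by
  unfold cmp at h
  split at h
  all_goals try cases h
  all_goals
    simp only [Bool.and_eq_true] at h
    refine Equal.apps ?_ (all₂_sound hr h.2)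
  · rw [Nat.eq_of_beq_eq_true h.1]; exact .rfl'
  · rw [Const.eq_of_beq h.1]; exact .rfl'
  · rw [Nat.eq_of_beq_eq_true h.1]; exact .rfl'
  · rw [Nat.eq_of_beq_eq_true h.1]; exact .rfl'
  · exact Conv.pi (hr _ _ h.1.1) (hr _ _ h.1.2)
  · exact (Conv.lam (.refl _) (hr _ _ h.1)).trans (Conv.lam_domain _ _ _)

theorem cmpEta_sound (hδ : ∀ k, (δ k).ClosedAt 0) {r : Tm → Tm → Bool}
    (hr : ∀ s t, r s t = true → Equal δ s t)
    {s t : Tm × List Tm} (h : cmpEta r s t = true) : Equal δ (s.1.apps s.2) (t.1.apps t.2) := by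
  have eta : ∀ (A b t : Tm), Equal δ b (.app (t.lift 1 0) (.var 0)) → Equal δ (.lam A b) t := by
    intro A b t h
    rw [Equal, expand, expand, expand_lift_zero hδ] at h
    exact (Conv.lam (.refl _) h).trans (.eta _ _)
  unfold cmpEta at h
  split at h
  · exact eta _ _ _ (hr _ _ h)
  · exact (eta _ _ _ (hr _ _ h).symm).symm
  · cases h

theorem Sound.conv (hE : E.Sound δ) {W N : ℕ} {s t : Tm} (h : E.conv W N s t = true) :
    Equal δ s t := by
  induction N generalizing s t with
  | zero => cases h
  | succ N ih =>
    simp only [Library.conv, Bool.or_eq_true] at h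
    have ih' : ∀ s t, E.conv W N s t = true → Equal δ s t := fun _ _ => ih
    rcases h with h | h
    · have := cmp_sound ih' h
      rwa [apps_spine, apps_spine] at this
    · refine (hE.whnf W s [] []).trans (Conv.trans ?_ (hE.whnf W t [] []).symm)
      rcases h with h | h
      · exact cmp_sound ih' h
      · exact cmpEta_sound hE.closed ih' h

theorem Sound.univOf (hE : E.Sound δ) {N : ℕ} {T : Tm × List Tm} {i : ℕ}
    (h : E.univOf N T = some i) : Conv ((T.1.close T.2).expand δ) (.univ i) := by
  unfold Library.univOf at h
  split at h
  · next j e =>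
    have := hE.whnf N T.1 T.2 []
    rw [e] at this
    cases h
    exact this
  · cases h

/-- Convertibility alone does not make the product a type. The flag marks the case without
computation, in which well-formedness is inherited from `T`. -/
theorem Sound.piOf (hE : E.Sound δ) {N : ℕ} {T : Tm × List Tm} {A B : Tm} {σ : List Tm} {b : Bool}
    (h : E.piOf N T = some (A, B, σ, b)) :
    Equal δ (T.1.close T.2) ((Tm.pi A B).close σ) ∧ (b = true → T = (.pi A B, σ)) ∧
      (T.2 = [] → σ = []) := by
  unfold Library.piOf at h
  split at h
  · cases h; exact ⟨.rfl', fun _ => rfl, id⟩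
  · split at h
    · next T σ _ _ _ _ e =>
      cases h
      have := hE.whnf N T σ []
      rw [e] at this
      exact ⟨this, fun h => (Bool.false_ne_true h).elim, fun _ => rfl⟩
    · cases h

theorem Sound.cumul (hE : E.Sound δ) {Γ : List Raw} {N : ℕ} {t : Raw} {S T : Tm}
    (h : cumul (E.whnf N S [] []) (E.whnf N T [] []) = true) (ht : HasType Γ t (S.expand δ))
    (hT : IsType Γ (T.expand δ)) : HasType Γ t (T.expand δ) := by
  have hs := hE.whnf N S [] []
  have hs' := hE.whnf N T [] []
  unfold Library.cumul at h
  split at h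
  · next i j e e' =>
    rw [e] at hs; rw [e'] at hs'
    obtain ⟨k, hT⟩ := hT
    exact ((ht.conv hs (.univ _ _)).univ_le (Nat.le_of_ble_eq_true h)).conv (Conv.symm hs') hT
  · cases h

/-- The induction on the fuel carries along that the resulting type is itself a type: the rule
`conv` demands this of its target, and the components of a product type inherit it through
`HasType.pi_inv`. -/
theorem Sound.check (hE : E.Sound δ) {W N : ℕ} {Γ : List Tm} {t : Tm} {o : Option Tm}
    {S : Tm × List Tm} (h : E.check W N Γ t o = some S) (hΓ : WfCtx (Γ.map (expand δ)))
    (ho : ∀ T, o = some T → IsType (Γ.map (expand δ)) (T.expand δ)) :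
    (∀ T, o = some T → S = (T, [])) ∧
    HasType (Γ.map (expand δ)) (t.expand δ) ((S.1.close S.2).expand δ) ∧
      IsType (Γ.map (expand δ)) ((S.1.close S.2).expand δ) := by
  induction N generalizing Γ t o S with
  | zero => cases h
  | succ N ih =>
    have inf : ∀ {Γ : List Tm} {t : Tm} {S : Tm × List Tm}, E.check W N Γ t none = some S →
        WfCtx (Γ.map (expand δ)) →
        HasType (Γ.map (expand δ)) (t.expand δ) ((S.1.close S.2).expand δ) ∧
        IsType (Γ.map (expand δ)) ((S.1.close S.2).expand δ) :=
      fun h hΓ => (ih h hΓ (by simp)).2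
    have chk : ∀ {Γ : List Tm} {t T : Tm} {S : Tm × List Tm}, E.check W N Γ t (some T) = some S →
        WfCtx (Γ.map (expand δ)) → IsType (Γ.map (expand δ)) (T.expand δ) →
        HasType (Γ.map (expand δ)) (t.expand δ) (T.expand δ) := by
      intro Γ t T S h hΓ hT
      have := ih h hΓ (by rintro _ ⟨⟩; exact hT)
      obtain rfl := this.1 T rfl
      exact this.2.1
    have typ : ∀ {Γ : List Tm} {A : Tm} {S : Tm × List Tm} {i : ℕ},
        E.check W N Γ A none = some S → E.univOf W S = some i → WfCtx (Γ.map (expand δ)) →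
        HasType (Γ.map (expand δ)) (A.expand δ) (.univ i) := by
      intro Γ A S i h hi hΓ
      exact (inf h hΓ).1.conv (hE.univOf hi) (.univ _ _)
    cases o with
    | none =>
      refine ⟨by simp, ?_⟩
      cases t with
      | var n =>
        simp only [Library.check, Option.map_eq_some_iff] at h
        obtain ⟨A, hA, rfl⟩ := h
        have hA' : (Γ.map (expand δ))[n]? = some (A.expand δ) := by simp [hA]
        rw [close, expand_lift_zero hE.closed]
        exact ⟨.var hA', hΓ n _ hA'⟩
      | const => cases h
      | univ i => cases h; exact ⟨.univ _ _, ⟨_, .univ _ _⟩⟩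
      | ref k =>
        simp only [Library.check, Option.map_eq_some_iff] at h
        obtain ⟨d, hd, rfl⟩ := h
        obtain ⟨i, hi⟩ := hE.isType k d hd
        exact ⟨(hE.hasType k d hd).of_closed _, ⟨i, hi.of_closed _⟩⟩
      | pi A B =>
        simp only [Library.check, Option.bind_eq_bind, Option.bind_eq_some_iff] at h
        obtain ⟨_, h₁, i, hi, _, h₂, j, hj, h⟩ := h
        cases h
        have hA := typ h₁ hi hΓ
        have hB := typ h₂ hj (hΓ.cons ⟨i, hA⟩)
        exact ⟨.pi (hA.univ_le (le_max_left i j)) (hB.univ_le (le_max_right i j)), ⟨_, .univ _ _⟩⟩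
      | lam A t =>
        simp only [Library.check, Option.bind_eq_bind, Option.bind_eq_some_iff] at h
        obtain ⟨_, h₁, i, hi, B, h₂, h⟩ := h
        cases h
        have hA := typ h₁ hi hΓ
        have ht := inf h₂ (hΓ.cons ⟨i, hA⟩)
        exact ⟨.lam hA ht.1, IsType.pi ⟨i, hA⟩ ht.2⟩
      | app f a =>
        simp only [Library.check, Option.bind_eq_bind, Option.bind_eq_some_iff] at h
        obtain ⟨F, h₁, ⟨A, B, σ, b⟩, hF, X, hX, Y, hY, h⟩ := h
        cases h
        obtain ⟨hf, hFt⟩ := inf h₁ hΓ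
        obtain ⟨e, e', _⟩ := hE.piOf hF
        have hpi : IsType (Γ.map (expand δ)) (((Tm.pi A B).close σ).expand δ) := by
          cases b with
          | true => rw [e' rfl] at hFt; exact hFt
          | false =>
            have := (inf hX hΓ).1
            rw [expand_close hE.closed] at this ⊢
            obtain ⟨hA, hB⟩ := this.pi_inv
            exact IsType.pi hA hB
        obtain ⟨k, hk⟩ := hpi
        have hf := hf.conv e hk
        rw [expand_close hE.closed] at hf hk
        obtain ⟨hA, j, hB⟩ := hk.pi_inv
        have ha := chk hY hΓ (by rw [expand_close hE.closed]; exact hA)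
        rw [expand_close hE.closed] at ha
        rw [expand_close hE.closed, rawSubst_cons, ← liftSubst_rawSubst]
        exact ⟨hf.app ha, ⟨j, hB.inst ha⟩⟩
    | some T =>
      have hT := ho T rfl
      suffices S = (T, []) ∧ HasType (Γ.map (expand δ)) (t.expand δ) (T.expand δ) by
        obtain ⟨rfl, h'⟩ := this
        exact ⟨by rintro _ ⟨⟩; rfl, h', hT⟩
      by_cases hl : ∃ A b, t = .lam A b
      · obtain ⟨A, t, rfl⟩ := hl
        simp only [Library.check] at h
        split at h
        · next A' B' σ b hF =>
          simp only [Option.bind_eq_bind, Option.bind_eq_some_iff] at h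
          obtain ⟨_, h₁, i, hi, X, hX, h⟩ := h
          cases hc : E.conv W W A A' with
          | false => simp [hc] at h
          | true =>
            simp only [hc, cond_true, Option.bind_eq_some_iff, Option.some.injEq] at h
            obtain ⟨_, h₂, rfl⟩ := h
            have hA := typ h₁ hi hΓ
            obtain ⟨e, e', e''⟩ := hE.piOf hF
            obtain rfl := e'' rfl
            have hpi : IsType (Γ.map (expand δ)) (expand δ (.pi A' B')) := by
              cases b with
              | true => obtain rfl : T = .pi A' B' := (Prod.ext_iff.1 (e' rfl)).1; exact hT
              | false =>
                obtain ⟨hA, hB⟩ := (inf hX hΓ).1.pi_inv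
                exact IsType.pi hA hB
            obtain ⟨k, hk⟩ := hpi
            obtain ⟨hA', j, hB'⟩ := hk.pi_inv
            -- The codomain `B'` is a type over `A'`, whereas the body is checked over the
            -- annotation `A`.
            have ht := chk h₂ (hΓ.cons ⟨i, hA⟩) ⟨j, hB'.conv_ctx (hE.conv hc) hA'⟩
            refine ⟨rfl, ?_⟩
            obtain ⟨k', hT⟩ := hT
            exact (HasType.lam hA ht).conv
              ((Conv.pi (hE.conv hc) (.refl _)).trans (Conv.symm e)) hT
        · cases h
      · have h' : ((E.check W N Γ t none).bind fun S =>
            bif E.conv W W (S.1.close S.2) T ||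
              Library.cumul (E.whnf W (S.1.close S.2) [] []) (E.whnf W T [] []) then some (T, [])
            else none) = some S := by
          cases t with
          | lam A b => exact absurd ⟨A, b, rfl⟩ hl
          | _ => exact h
        obtain ⟨S', h₁, h₂⟩ := Option.bind_eq_some_iff.1 h'
        have hS := inf h₁ hΓ
        cases hb : E.conv W W (S'.1.close S'.2) T ||
            Library.cumul (E.whnf W (S'.1.close S'.2) [] []) (E.whnf W T [] []) with
        | false => simp [hb] at h₂
        | true =>
          simp only [hb, cond_true, Option.some.injEq] at h₂
          refine ⟨h₂.symm, ?_⟩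
          rcases Bool.or_eq_true_iff.1 hb with hc | hc
          · obtain ⟨k, hT⟩ := hT
            exact hS.1.conv (hE.conv hc) hT
          · exact hE.cumul hc hS.1 hT

end Library

/-! ### Soundness of libraries -/

/-- Equality of raw terms. -/
def Raw.beq : Raw → Raw → Bool
  | .var i, .var j => Nat.beq i j
  | .const c, .const d => c.beq d
  | .univ i, .univ j => Nat.beq i j
  | .pi A B, .pi A' B' => A.beq A' && B.beq B'
  | .lam A t, .lam A' t' => A.beq A' && t.beq t'
  | .app f a, .app f' a' => f.beq f' && a.beq a'
  | _, _ => false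

theorem Raw.eq_of_beq {s t : Raw} (h : s.beq t = true) : s = t := by
  induction s generalizing t with
  | var i => cases t <;> first | cases h | exact congrArg _ (Nat.eq_of_beq_eq_true h)
  | const i => cases t <;> first | cases h | exact congrArg _ (Const.eq_of_beq h)
  | univ i => cases t <;> first | cases h | exact congrArg _ (Nat.eq_of_beq_eq_true h)
  | pi A B hA hB | lam A B hA hB | app A B hA hB =>
    cases t <;> try (cases h)
    simp only [beq, Bool.and_eq_true] at h
    rw [hA h.1, hB h.2]

namespace Library

/-- The definition `k := b : T` extends the library correctly (`b` may be a primitive constant). -/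
def admits (E : Library) (N k : ℕ) (b T : Tm) : Bool :=
  (((E.lookup k).isNone && ((E.check N N [] T none).bind (E.univOf N)).isSome) &&
    (b.refsAll (fun n => (E.lookup n).isSome) && T.refsAll fun n => (E.lookup n).isSome)) &&
  match b with
  -- The declared type must unfold to the prescribed one literally, not only up to conversion.
  | .const c => (T.expand E.den).beq (c.type 0)
  | b => (E.check N N [] b (some T)).isSome

/-- The library consists of definitions each of which is admitted by the preceding ones. -/
structure Good (E : Library) : Prop where
  sound : E.Sound E.den
  refs : ∀ k d, E.lookup k = some d → d.1.refsAll (fun n => (E.lookup n).isSome) = true ∧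
    d.2.refsAll (fun n => (E.lookup n).isSome) = true

theorem Good.nil : Good [] where
  sound := ⟨fun _ => trivial, nofun, nofun, nofun⟩
  refs := nofun

/-- The key `k` is fresh and all references point to earlier entries, so the new entry changes no
old expansion. What remains is the typing of the new entry, by `Sound.check` or by the rule for
constants. -/
theorem Good.cons {E : Library} (hE : E.Good) {N k : ℕ} {b T : Tm}
    (h : E.admits N k b T = true) : Good ((k, b, T) :: E) := by
  simp only [admits, Bool.and_eq_true] at h
  obtain ⟨⟨⟨hk, hT⟩, hb', hT'⟩, hb⟩ := h
  have hk : E.lookup k = none := by simpa using hk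
  have lookup_ne : ∀ {n d}, E.lookup n = some d → lookup ((k, b, T) :: E) n = some d := by
    intro n d hn
    have : Nat.beq n k = false :=
      Bool.eq_false_iff.2 fun h => by rw [Nat.eq_of_beq_eq_true h, hk] at hn; cases hn
    simpa [lookup, this] using hn
  have mono : ∀ n, (E.lookup n).isSome = true → (lookup ((k, b, T) :: E) n).isSome = true := by
    intro n hn
    obtain ⟨d, hd⟩ := Option.isSome_iff_exists.1 hn
    rw [lookup_ne hd]; rfl
  have den_ne : ∀ n, (E.lookup n).isSome = true → E.den n = den ((k, b, T) :: E) n := by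
    intro n hn
    obtain ⟨d, hd⟩ := Option.isSome_iff_exists.1 hn
    have : Nat.beq n k = false :=
      Bool.eq_false_iff.2 fun h => by rw [Nat.eq_of_beq_eq_true h, hk] at hd; cases hd
    simp [den, this]
  have expand_eq : ∀ {t : Tm}, t.refsAll (fun n => (E.lookup n).isSome) = true →
      t.expand E.den = t.expand (den ((k, b, T) :: E)) := fun ht => Tm.expand_congr den_ne ht
  obtain ⟨i, hTi⟩ : IsType [] (T.expand E.den) := by
    obtain ⟨i, hi⟩ := Option.isSome_iff_exists.1 hT
    obtain ⟨S, hS, hi⟩ := Option.bind_eq_some_iff.1 hi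
    exact ⟨i, (hE.sound.check hS .nil (by simp)).2.1.conv (hE.sound.univOf hi) (.univ _ _)⟩
  have hbT : HasType [] (b.expand E.den) (T.expand E.den) := by
    split at hb
    · rw [Raw.eq_of_beq hb]; exact .const _ _
    · obtain ⟨S, hS⟩ := Option.isSome_iff_exists.1 hb
      have := hE.sound.check hS .nil (by rintro _ ⟨⟩; exact ⟨i, hTi⟩)
      obtain rfl := this.1 T rfl
      exact this.2.1
  have den_self : den ((k, b, T) :: E) k = b.expand E.den := by simp [den]
  have cases_lookup : ∀ {n d}, lookup ((k, b, T) :: E) n = some d →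
      n = k ∧ d = (b, T) ∨ E.lookup n = some d := by
    intro n d hd
    cases hnk : Nat.beq n k with
    | true =>
      simp only [lookup, hnk, cond_true, Option.some.injEq] at hd
      exact .inl ⟨Nat.eq_of_beq_eq_true hnk, hd.symm⟩
    | false => exact .inr (by simpa [lookup, hnk] using hd)
  refine ⟨⟨?_, ?_, ?_, ?_⟩, ?_⟩
  · intro n
    simp only [den]
    cases Nat.beq n k with
    | true => exact hbT.closedAt
    | false => exact hE.sound.closed n
  · intro n d hd
    rcases cases_lookup hd with ⟨rfl, rfl⟩ | hd
    · rw [den_self]; exact expand_eq hb'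
    · rw [← den_ne n (by simp [hd]), hE.sound.unfold n d hd]
      exact expand_eq (hE.refs n d hd).1
  · intro n d hd
    rcases cases_lookup hd with ⟨rfl, rfl⟩ | hd
    · rw [den_self, ← expand_eq hT']; exact hbT
    · rw [← den_ne n (by simp [hd]), ← expand_eq (hE.refs n d hd).2]
      exact hE.sound.hasType n d hd
  · intro n d hd
    rcases cases_lookup hd with ⟨rfl, rfl⟩ | hd
    · rw [← expand_eq hT']; exact ⟨i, hTi⟩
    · rw [← expand_eq (hE.refs n d hd).2]
      exact hE.sound.isType n d hd
  · intro n d hd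
    rcases cases_lookup hd with ⟨rfl, rfl⟩ | hd
    · exact ⟨Tm.refsAll_mono mono hb', Tm.refsAll_mono mono hT'⟩
    · exact ⟨Tm.refsAll_mono mono (hE.refs n d hd).1, Tm.refsAll_mono mono (hE.refs n d hd).2⟩

/-- All entries are admitted by the preceding ones. -/
def ok (N : ℕ) : Library → Bool
  | [] => true
  | (k, b, T) :: E => ok N E && admits E N k b T

theorem good_of_ok {N : ℕ} : ∀ {E : Library}, E.ok N = true → E.Good
  | [], _ => .nil
  | (k, b, T) :: E, h => by
    simp only [ok, Bool.and_eq_true] at h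
    exact (good_of_ok h.1).cons h.2

end Library

/-! ### Syntax for the library entries -/

/-- The reference to a primitive constant. -/
def Const.id (c : Const) : ℕ := c.code.1 * 9 + c.code.2.1 * 3 + c.code.2.2

/-- A raw term, with references to the primitive constants. -/
def Raw.quote : Raw → Tm
  | var n => .var n
  | const c => .ref c.id
  | univ i => .univ i
  | pi A B => .pi A.quote B.quote
  | lam A t => .lam A.quote t.quote
  | app f a => .app f.quote a.quote

/-- A term with references, as a function of the number of variables in scope. -/
abbrev Syn : Type := ℕ → Tm

namespace Syn

def bound (d : ℕ) : Syn := fun k => .var (k - 1 - d)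

def pi (A : Syn) (B : Syn → Syn) : Syn := fun d => .pi (A d) (B (bound d) (d + 1))

def lam (A : Syn) (t : Syn → Syn) : Syn := fun d => .lam (A d) (t (bound d) (d + 1))

def app (f a : Syn) : Syn := fun d => .app (f d) (a d)

def U (i : ℕ) : Syn := fun _ => .univ i

def ref (k : ℕ) : Syn := fun _ => .ref k

def cst (c : Const) : Syn := fun _ => .ref c.id

def ofTerm (T : Term) : Syn := fun d => (T d).quote

local infixl:90 " ⋄ " => app

def arrow (A B : Syn) : Syn := pi A fun _ => B

local infixr:50 " ⟹ " => arrow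

/-- A term with its type. -/
abbrev Typed : Type := Syn × Syn

/-- Abstraction over `x : A` in a term and in its type. -/
def abs (A : Syn) (F : Syn → Typed) : Typed := (lam A fun x => (F x).1, pi A fun x => (F x).2)

/-! #### Basic constructions -/

def sigma (i : ℕ) (A : Syn) (B : Syn → Syn) : Syn := cst (.sigma i) ⋄ A ⋄ lam A B

def pair (i : ℕ) (A : Syn) (B : Syn → Syn) (a b : Syn) : Syn :=
  cst (.pair i) ⋄ A ⋄ lam A B ⋄ a ⋄ b

def sigmaInd (i j : ℕ) (A : Syn) (B : Syn → Syn) (C : Syn → Syn) (s : Syn → Syn → Syn) (z : Syn) :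
    Syn :=
  cst (.sigmaInd i j) ⋄ A ⋄ lam A B ⋄ lam (sigma i A B) C ⋄ lam A (fun a => lam (B a) (s a)) ⋄ z

def fst (i : ℕ) (A : Syn) (B : Syn → Syn) (z : Syn) : Syn := ref (300 + i) ⋄ A ⋄ lam A B ⋄ z

def snd (i : ℕ) (A : Syn) (B : Syn → Syn) (z : Syn) : Syn := ref (302 + i) ⋄ A ⋄ lam A B ⋄ z

def prod (i : ℕ) (A B : Syn) : Syn := sigma i A fun _ => B

def nat : Syn := cst .nat

def empty : Syn := cst .empty

def eq (i : ℕ) (A x y : Syn) : Syn := cst (.eq i) ⋄ A ⋄ x ⋄ y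

def refl (i : ℕ) (A x : Syn) : Syn := cst (.refl i) ⋄ A ⋄ x

def eqInd (i j : ℕ) (A x : Syn) (C : Syn → Syn → Syn) (c y p : Syn) : Syn :=
  cst (.eqInd i j) ⋄ A ⋄ x ⋄ lam A (fun y' => lam (eq i A x y') fun p' => C y' p') ⋄ c ⋄ y ⋄ p

def trans (i : ℕ) (A x y z p q : Syn) : Syn := ref (304 + i) ⋄ A ⋄ x ⋄ y ⋄ z ⋄ p ⋄ q

def ap (i : ℕ) (A B f x y p : Syn) : Syn := ref (306 + i) ⋄ A ⋄ B ⋄ f ⋄ x ⋄ y ⋄ p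

def symm (i : ℕ) (A x y p : Syn) : Syn := ref (308 + i) ⋄ A ⋄ x ⋄ y ⋄ p

/-- The concatenation of `p : x = y` with a list of paths, given with their end points. -/
def chain (i : ℕ) (A x y p : Syn) : List (Syn × Syn) → Syn
  | [] => p
  | (q, z) :: l => chain i A x z (trans i A x y z p q) l

def transport (i j : ℕ) (A : Syn) (P : Syn → Syn) (x y p u : Syn) : Syn :=
  eqInd i j A x (fun y' _ => P y') u y p

def apd (i j : ℕ) (A : Syn) (P : Syn → Syn) (f x y p : Syn) : Syn :=
  eqInd i j A x (fun y' p' => eq j (P y') (transport i j A P x y' p' (f ⋄ x)) (f ⋄ y'))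
    (refl j (P x) (f ⋄ x)) y p

def transportConst (i j : ℕ) (A B x y p u : Syn) : Syn :=
  eqInd i j A x (fun y' p' => eq j B (transport i j A (fun _ => B) x y' p' u) u)
    (refl j B u) y p

def leftInv (i : ℕ) (A B f : Syn) : Syn :=
  sigma i (B ⟹ A) fun g => pi A fun x => eq i A (g ⋄ (f ⋄ x)) x

def rightInv (i : ℕ) (A B f : Syn) : Syn :=
  sigma i (B ⟹ A) fun g => pi B fun y => eq i B (f ⋄ (g ⋄ y)) y

def isEquiv (i : ℕ) (A B f : Syn) : Syn := prod i (leftInv i A B f) (rightInv i A B f)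

def equiv (i : ℕ) (A B : Syn) : Syn := sigma i (A ⟹ B) fun f => isEquiv i A B f

def coe (i : ℕ) (A B p : Syn) : Syn :=
  lam A fun x => transport (i + 1) i (U i) (fun X => X) A B p x

/-- A library entry for a primitive constant. -/
def prim (c : Const) : ℕ × Tm × Tm := (c.id, .const c, (c.type 0).quote)

/-- A library entry. -/
def entry (k : ℕ) (t : Typed) : ℕ × Tm × Tm := (k, t.1 0, t.2 0)

/-- The body is the term from the statement itself. Entries that occur in the theorem must unfold to
it literally, since the final comparison is syntactic. -/
def fstFun (i : ℕ) : Typed :=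
  (ofTerm (HoTT.fstFun i),
    pi (U i) fun A => pi (A ⟹ U i) fun B => pi (sigma i A fun x => B ⋄ x) fun _ => A)

def sndFun (i : ℕ) : Typed :=
  (ofTerm (HoTT.sndFun i),
    pi (U i) fun A => pi (A ⟹ U i) fun B => pi (sigma i A fun x => B ⋄ x) fun z =>
      B ⋄ (ref (300 + i) ⋄ A ⋄ B ⋄ z))

def transFun (i : ℕ) : Typed :=
  (ofTerm (HoTT.transFun i),
    pi (U i) fun A => pi A fun x => pi A fun y => pi A fun z =>
      pi (eq i A x y) fun _ => pi (eq i A y z) fun _ => eq i A x z)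

def apFun (i : ℕ) : Typed :=
  (ofTerm (HoTT.apFun i i),
    pi (U i) fun A => pi (U i) fun B => pi (A ⟹ B) fun f => pi A fun x => pi A fun y =>
      pi (eq i A x y) fun _ => eq i B (f ⋄ x) (f ⋄ y))

def symmFun (i : ℕ) : Typed :=
  abs (U i) fun A => abs A fun x => abs A fun y => abs (eq i A x y) fun p =>
    (eqInd i i A x (fun y' _ => eq i A y' x) (refl i A x) y p, eq i A y x)

/-- The primitive constants that are used, and basic functions. -/
def basicLibrary : Library :=
  -- A library has its latest entry at the head.
  List.reverse <| [Const.nat, .zero, .succ, .natInd 0, .natInd 1, .empty, .emptyInd 0,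
    .sigma 0, .sigma 1, .pair 0, .pair 1, .sigmaInd 0 0, .sigmaInd 1 1, .eq 0, .eq 1,
    .refl 0, .refl 1, .eqInd 0 0, .eqInd 0 1, .eqInd 1 0, .eqInd 1 1,
    .circle, .base, .loop, .pushout 0, .inl 0, .inr 0, .glue 0, .pushoutInd 0 0, .pushoutGlue 0 0,
    .trunc 0, .funext 0, .univalence 0].map prim ++
  [entry 300 (fstFun 0), entry 301 (fstFun 1), entry 302 (sndFun 0), entry 303 (sndFun 1),
    entry 304 (transFun 0), entry 305 (transFun 1), entry 306 (apFun 0), entry 307 (apFun 1),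
    entry 308 (symmFun 0), entry 309 (symmFun 1)]

/-! #### Spans and pushouts -/

/-- The data `X`, `A`, `B`, `f : X → A`, `g : X → B` or `A`, `B`, `C`, `f : A → C`, `g : B → C`. -/
structure Span where
  (X A B f g : Syn)

namespace Span

def apply (t : Syn) (S : Span) : Syn := t ⋄ S.X ⋄ S.A ⋄ S.B ⋄ S.f ⋄ S.g

def po (S : Span) : Syn := S.apply (cst (.pushout 0))

def inl (S : Span) (a : Syn) : Syn := S.apply (cst (.inl 0)) ⋄ a

def inr (S : Span) (b : Syn) : Syn := S.apply (cst (.inr 0)) ⋄ b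

def glue (S : Span) (x : Syn) : Syn := S.apply (cst (.glue 0)) ⋄ x

/-- The function given by `pushoutRec`. -/
def recFun (S : Span) (Y l r h : Syn) : Syn := S.apply (ref 312) ⋄ Y ⋄ l ⋄ r ⋄ h

end Span

/-- Abstraction over a span. -/
def absSpan (F : Span → Typed) : Typed :=
  abs (U 0) fun X => abs (U 0) fun A => abs (U 0) fun B =>
    abs (X ⟹ A) fun f => abs (X ⟹ B) fun g => F ⟨X, A, B, f, g⟩

/-- Abstraction over a cospan. -/
def absCospan (F : Span → Typed) : Typed :=
  abs (U 0) fun A => abs (U 0) fun B => abs (U 0) fun C =>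
    abs (A ⟹ C) fun f => abs (B ⟹ C) fun g => F ⟨A, B, C, f, g⟩

def isEquivFun : Typed :=
  abs (U 0) fun A => abs (U 0) fun B => abs (A ⟹ B) fun f => (isEquiv 0 A B f, U 0)

def coeInvFun : Typed :=
  (ofTerm (HoTT.coeInvFun 0),
    pi (U 0) fun A => pi (U 0) fun B => pi (eq 1 (U 0) A B) fun _ => B ⟹ A)

def pushoutRec : Typed :=
  absSpan fun S => abs (U 0) fun Y => abs (S.A ⟹ Y) fun l => abs (S.B ⟹ Y) fun r =>
  abs (pi S.X fun x => eq 0 Y (l ⋄ (S.f ⋄ x)) (r ⋄ (S.g ⋄ x))) fun h =>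
    (S.apply (cst (.pushoutInd 0 0)) ⋄ lam S.po (fun _ => Y) ⋄ l ⋄ r ⋄
      lam S.X fun x =>
        let u := S.inl (S.f ⋄ x)
        let v := S.inr (S.g ⋄ x)
        let q := S.glue x
        trans 0 Y (transport 0 0 S.po (fun _ => Y) u v q (l ⋄ (S.f ⋄ x))) (l ⋄ (S.f ⋄ x))
          (r ⋄ (S.g ⋄ x)) (transportConst 0 0 S.po Y u v q (l ⋄ (S.f ⋄ x))) (h ⋄ x),
      S.po ⟹ Y)

/-! #### Pullbacks and joins -/

/-- The family of which the pullback is the total space. -/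
def pbFam (S : Span) : Syn → Syn := fun x => sigma 0 S.A fun y => eq 0 S.B (S.f ⋄ x) (S.g ⋄ y)

def pullback : Typed := absCospan fun S => (sigma 0 S.X (pbFam S), U 0)

def pb (S : Span) : Syn := S.apply (ref 313)

def pullbackFst : Typed :=
  absCospan fun S => abs (pb S) fun z => (fst 0 S.X (pbFam S) z, S.X)

def pullbackSnd : Typed :=
  absCospan fun S => abs (pb S) fun z =>
    (fst 0 S.A (fun y => eq 0 S.B (S.f ⋄ fst 0 S.X (pbFam S) z) (S.g ⋄ y))
      (snd 0 S.X (pbFam S) z), S.A)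

def pbFst (S : Span) : Syn := S.apply (ref 314)

def pbSnd (S : Span) : Syn := S.apply (ref 315)

def pullbackPath : Typed :=
  absCospan fun S => abs (pb S) fun z =>
    (snd 0 S.A (fun y => eq 0 S.B (S.f ⋄ fst 0 S.X (pbFam S) z) (S.g ⋄ y))
      (snd 0 S.X (pbFam S) z), eq 0 S.B (S.f ⋄ (pbFst S ⋄ z)) (S.g ⋄ (pbSnd S ⋄ z)))

def pbPath (S : Span) : Syn := S.apply (ref 316)

/-- The element of the pullback given by `x`, `y` and `e : f x = g y`. -/
def pbMk (S : Span) (x y e : Syn) : Syn :=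
  pair 0 S.X (pbFam S) x (pair 0 S.A (fun y => eq 0 S.B (S.f ⋄ x) (S.g ⋄ y)) y e)

/-- Induction on an element of the pullback. -/
def pbInd (S : Span) (M : Syn → Syn) (m : Syn → Syn → Syn → Syn) (z : Syn) : Syn :=
  sigmaInd 0 0 S.X (pbFam S) M (fun x s =>
    sigmaInd 0 0 S.A (fun y => eq 0 S.B (S.f ⋄ x) (S.g ⋄ y))
      (fun s => M (pair 0 S.X (pbFam S) x s)) (m x) s) z

/-- The span of which the join is the pushout. -/
def joinSpan (S : Span) : Span := ⟨pb S, S.X, S.A, pbFst S, pbSnd S⟩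

def join : Typed := absCospan fun S => ((joinSpan S).po, U 0)

def jn (S : Span) : Syn := S.apply (ref 317)

def joinMap : Typed :=
  absCospan fun S => ((joinSpan S).recFun S.B S.f S.g (pbPath S), jn S ⟹ S.B)

def jnMap (S : Span) : Syn := S.apply (ref 318)

/-! #### Types over a type -/

def typeOver (C : Syn) : Syn := sigma 1 (U 0) fun X => X ⟹ C

/-- The type over `C` given by `u : X → C`. -/
def obj (C X u : Syn) : Syn := pair 1 (U 0) (fun X => X ⟹ C) X u

def src (C Z : Syn) : Syn := fst 1 (U 0) (fun X => X ⟹ C) Z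

def str (C Z : Syn) : Syn := snd 1 (U 0) (fun X => X ⟹ C) Z

/-- Abstraction over a map and a natural number. -/
def absMap (F : Syn → Syn → Syn → Syn → Typed) : Typed :=
  abs (U 0) fun A => abs (U 0) fun C => abs (A ⟹ C) fun f => abs nat fun n => F A C f n

def iterJoin : Typed :=
  absMap fun A C f n =>
    (cst (.natInd 1) ⋄ lam nat (fun _ => typeOver C) ⋄
      obj C empty (cst (.emptyInd 0) ⋄ lam empty fun _ => C) ⋄
      lam nat (fun _ => lam (typeOver C) fun Y =>
        let S : Span := ⟨src C Y, A, C, str C Y, f⟩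
        obj C (jn S) (jnMap S)) ⋄ n, typeOver C)

def itJoin (A C f n : Syn) : Syn := ref 319 ⋄ A ⋄ C ⋄ f ⋄ n

def iterJoinType : Typed := absMap fun A C f n => (src C (itJoin A C f n), U 0)

def itType (A C f n : Syn) : Syn := ref 320 ⋄ A ⋄ C ⋄ f ⋄ n

def iterJoinMap : Typed := absMap fun A C f n => (str C (itJoin A C f n), itType A C f n ⟹ C)

def itMap (A C f n : Syn) : Syn := ref 321 ⋄ A ⋄ C ⋄ f ⋄ n

/-! #### The pushout square -/

/-- Abstraction over the data of the square. -/
def absSquare (F : Span → Syn → Syn → Syn → Typed) : Typed :=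
  absCospan fun S => abs (U 0) fun Y => abs (Y ⟹ S.A) fun r =>
    abs (eq 1 (U 0) (pb S) Y) fun p => F S Y r p

def toPullback (S : Span) (Y p : Syn) : Syn := ref 311 ⋄ pb S ⋄ Y ⋄ p

def leftMap : Typed :=
  absSquare fun S Y _ p =>
    (lam Y fun y => pbFst S ⋄ (toPullback S Y p ⋄ y), Y ⟹ S.X)

def left (S : Span) (Y r p : Syn) : Syn := S.apply (ref 322) ⋄ Y ⋄ r ⋄ p

def overBase : Typed :=
  absSquare fun S Y r p =>
    (pi Y fun y => eq 0 S.A (pbSnd S ⋄ (toPullback S Y p ⋄ y)) (r ⋄ y), U 0)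

def overTy (S : Span) (Y r p : Syn) : Syn := S.apply (ref 323) ⋄ Y ⋄ r ⋄ p

def comparison : Typed :=
  absSquare fun S Y r p => abs (overTy S Y r p) fun h =>
    let J := joinSpan S
    let i₁ := J.apply (cst (.inl 0))
    let i₂ := J.apply (cst (.inr 0))
    let T : Span := ⟨Y, S.X, S.A, left S Y r p, r⟩
    (T.recFun (jn S) i₁ i₂ (lam Y fun y =>
        let z := toPullback S Y p ⋄ y
        trans 0 (jn S) (i₁ ⋄ (pbFst S ⋄ z)) (i₂ ⋄ (pbSnd S ⋄ z)) (i₂ ⋄ (r ⋄ y))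
          (J.glue z) (ap 0 S.A (jn S) i₂ (pbSnd S ⋄ z) (r ⋄ y) (h ⋄ y))),
      T.po ⟹ jn S)

def comp (S : Span) (Y r p h : Syn) : Syn := S.apply (ref 324) ⋄ Y ⋄ r ⋄ p ⋄ h

def joinLibrary : Library :=
  List.reverse [entry 310 isEquivFun, entry 311 coeInvFun, entry 312 pushoutRec,
    entry 313 pullback, entry 314 pullbackFst, entry 315 pullbackSnd, entry 316 pullbackPath,
    entry 317 join, entry 318 joinMap, entry 319 iterJoin, entry 320 iterJoinType,
    entry 321 iterJoinMap, entry 322 leftMap, entry 323 overBase, entry 324 comparison] ++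
  basicLibrary

/-! #### Paths -/

/-- `refl · p = p`. -/
def reflTrans : Typed :=
  abs (U 0) fun A => abs A fun x => abs A fun y => abs (eq 0 A x y) fun p =>
    -- `trans` recurses on its second path, so `p · refl` is `p` by definition and only this unit
    -- law needs an induction.
    (eqInd 0 0 A x (fun y p => eq 0 (eq 0 A x y) (trans 0 A x x y (refl 0 A x) p) p)
      (refl 0 (eq 0 A x x) (refl 0 A x)) y p,
    eq 0 (eq 0 A x y) (trans 0 A x x y (refl 0 A x) p) p)

/-- Left cancellation. -/
def cancelLeft : Typed :=
  abs (U 0) fun A => abs A fun x => abs A fun y => abs (eq 0 A x y) fun p =>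
  let T := fun y p => pi A fun z => pi (eq 0 A y z) fun q => pi (eq 0 A y z) fun r =>
    pi (eq 0 (eq 0 A x z) (trans 0 A x y z p q) (trans 0 A x y z p r)) fun _ =>
      eq 0 (eq 0 A y z) q r
  (eqInd 0 0 A x T
    (lam A fun z => lam (eq 0 A x z) fun q => lam (eq 0 A x z) fun r =>
      let R := refl 0 A x
      let q' := trans 0 A x x z R q
      let r' := trans 0 A x x z R r
      lam (eq 0 (eq 0 A x z) q' r') fun h =>
        chain 0 (eq 0 A x z) q q' (symm 0 (eq 0 A x z) q' q (ref 330 ⋄ A ⋄ x ⋄ z ⋄ q))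
          [(h, r'), (ref 330 ⋄ A ⋄ x ⋄ z ⋄ r, r)]) y p,
    T y p)

/-- Application of a composite of functions to a path. -/
def apComp : Typed :=
  abs (U 0) fun A => abs (U 0) fun B => abs (U 0) fun C => abs (A ⟹ B) fun f =>
  abs (B ⟹ C) fun g => abs A fun x => abs A fun y => abs (eq 0 A x y) fun p =>
  let T := fun y p => eq 0 (eq 0 C (g ⋄ (f ⋄ x)) (g ⋄ (f ⋄ y)))
    (ap 0 A C (lam A fun x => g ⋄ (f ⋄ x)) x y p)
    (ap 0 B C g (f ⋄ x) (f ⋄ y) (ap 0 A B f x y p))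
  (eqInd 0 0 A x T (refl 0 (eq 0 C (g ⋄ (f ⋄ x)) (g ⋄ (f ⋄ x))) (refl 0 C (g ⋄ (f ⋄ x)))) y p,
    T y p)

/-- Application of the identity function to a path. -/
def apId : Typed :=
  abs (U 0) fun A => abs A fun x => abs A fun y => abs (eq 0 A x y) fun p =>
  let T := fun y p => eq 0 (eq 0 A x y) (ap 0 A A (lam A fun x => x) x y p) p
  (eqInd 0 0 A x T (refl 0 (eq 0 A x x) (refl 0 A x)) y p, T y p)

/-- Application of a constant function to a path. -/
def apConst : Typed :=
  abs (U 0) fun A => abs (U 0) fun B => abs B fun b => abs A fun x => abs A fun y =>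
  abs (eq 0 A x y) fun p =>
  let T := fun y p => eq 0 (eq 0 B b b) (ap 0 A B (lam A fun _ => b) x y p) (refl 0 B b)
  (eqInd 0 0 A x T (refl 0 (eq 0 B b b) (refl 0 B b)) y p, T y p)

/-- `apd` of a nondependent function. -/
def apdConst : Typed :=
  abs (U 0) fun A => abs (U 0) fun B => abs (A ⟹ B) fun f => abs A fun x => abs A fun y =>
  abs (eq 0 A x y) fun p =>
  let P := fun _ => B
  let T := fun y p =>
    let u := transport 0 0 A P x y p (f ⋄ x)
    eq 0 (eq 0 B u (f ⋄ y)) (apd 0 0 A P f x y p)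
      (trans 0 B u (f ⋄ x) (f ⋄ y) (transportConst 0 0 A B x y p (f ⋄ x)) (ap 0 A B f x y p))
  (eqInd 0 0 A x T (refl 0 (eq 0 B (f ⋄ x) (f ⋄ x)) (refl 0 B (f ⋄ x))) y p, T y p)

/-- Transport in a family of identity types. -/
def transportEq : Typed :=
  abs (U 0) fun A => abs (U 0) fun B => abs (A ⟹ B) fun k => abs (A ⟹ B) fun l =>
  abs A fun x => abs A fun y => abs (eq 0 A x y) fun p => abs (eq 0 B (k ⋄ x) (l ⋄ x)) fun a =>
  let T := fun y p => pi (eq 0 B (k ⋄ y) (l ⋄ y)) fun b =>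
    pi (eq 0 (eq 0 B (k ⋄ x) (l ⋄ y))
      (trans 0 B (k ⋄ x) (l ⋄ x) (l ⋄ y) a (ap 0 A B l x y p))
      (trans 0 B (k ⋄ x) (k ⋄ y) (l ⋄ y) (ap 0 A B k x y p) b)) fun _ =>
    eq 0 (eq 0 B (k ⋄ y) (l ⋄ y)) (transport 0 0 A (fun y => eq 0 B (k ⋄ y) (l ⋄ y)) x y p a) b
  let E := eq 0 B (k ⋄ x) (l ⋄ x)
  -- For `p = refl` the hypothesis reads `a = refl · b`, and the transport of `a` is `a`.
  (eqInd 0 0 A x T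
    (lam E fun b =>
      let b' := trans 0 B (k ⋄ x) (k ⋄ x) (l ⋄ x) (refl 0 B (k ⋄ x)) b
      lam (eq 0 E a b') fun h =>
        trans 0 E a b' b h (ref 330 ⋄ B ⋄ (k ⋄ x) ⋄ (l ⋄ x) ⋄ b)) y p,
    T y p)

/-- Path induction at the other end point. -/
def eqIndRight : Typed :=
  abs (U 0) fun A => abs A fun x => abs A fun y => abs (eq 0 A x y) fun p =>
  let T := fun y p => pi (pi A fun x => eq 0 A x y ⟹ U 0) fun M =>
    pi (M ⋄ y ⋄ refl 0 A y) fun _ => M ⋄ x ⋄ p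
  -- The motive quantifies over families in `U 0`, hence lives in `U 1`.
  (eqInd 0 1 A x T
    (lam (pi A fun x' => eq 0 A x' x ⟹ U 0) fun M => lam (M ⋄ x ⋄ refl 0 A x) fun m => m) y p,
    T y p)

/-! #### Pushouts -/

/-- The effect of `pushoutRec` on the paths. -/
def recGlue : Typed :=
  absSpan fun S => abs (U 0) fun Y => abs (S.A ⟹ Y) fun l => abs (S.B ⟹ Y) fun r =>
  abs (pi S.X fun x => eq 0 Y (l ⋄ (S.f ⋄ x)) (r ⋄ (S.g ⋄ x))) fun h => abs S.X fun x =>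
    let k := S.recFun Y l r h
    let u := S.inl (S.f ⋄ x)
    let v := S.inr (S.g ⋄ x)
    let q := S.glue x
    let y := l ⋄ (S.f ⋄ x)
    let z := r ⋄ (S.g ⋄ x)
    let w := transport 0 0 S.po (fun _ => Y) u v q y
    let t := transportConst 0 0 S.po Y u v q y
    let H := lam S.X fun x =>
      let u := S.inl (S.f ⋄ x)
      let v := S.inr (S.g ⋄ x)
      let q := S.glue x
      let y := l ⋄ (S.f ⋄ x)
      trans 0 Y (transport 0 0 S.po (fun _ => Y) u v q y) y (r ⋄ (S.g ⋄ x))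
        (transportConst 0 0 S.po Y u v q y) (h ⋄ x)
    let α := ap 0 S.po Y k u v q
    let d := apd 0 0 S.po (fun _ => Y) k u v q
    let E := eq 0 Y w z
    -- The dependent action on the glue path is `t · α` by `apdConst` and `t · h x` by the rule of
    -- the eliminator; cancel `t`.
    (ref 331 ⋄ Y ⋄ w ⋄ y ⋄ t ⋄ z ⋄ α ⋄ (h ⋄ x) ⋄
      trans 0 E (trans 0 Y w y z t α) d (trans 0 Y w y z t (h ⋄ x))
        (symm 0 E d (trans 0 Y w y z t α) (ref 335 ⋄ S.po ⋄ Y ⋄ k ⋄ u ⋄ v ⋄ q))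
        (S.apply (cst (.pushoutGlue 0 0)) ⋄ lam S.po (fun _ => Y) ⋄ l ⋄ r ⋄ H ⋄ x),
    eq 0 (eq 0 Y y z) α (h ⋄ x))

/-- Functions on a pushout that agree on both sides and on the paths are equal. -/
def pushoutExt : Typed :=
  absSpan fun S => abs (U 0) fun Y => abs (S.po ⟹ Y) fun k => abs (S.po ⟹ Y) fun l =>
  abs (pi S.A fun a => eq 0 Y (k ⋄ S.inl a) (l ⋄ S.inl a)) fun α =>
  abs (pi S.B fun b => eq 0 Y (k ⋄ S.inr b) (l ⋄ S.inr b)) fun β =>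
  abs (pi S.X fun x =>
    let u := S.inl (S.f ⋄ x)
    let v := S.inr (S.g ⋄ x)
    eq 0 (eq 0 Y (k ⋄ u) (l ⋄ v))
      (trans 0 Y (k ⋄ u) (l ⋄ u) (l ⋄ v) (α ⋄ (S.f ⋄ x)) (ap 0 S.po Y l u v (S.glue x)))
      (trans 0 Y (k ⋄ u) (k ⋄ v) (l ⋄ v) (ap 0 S.po Y k u v (S.glue x)) (β ⋄ (S.g ⋄ x)))) fun γ =>
    (S.apply (cst (.pushoutInd 0 0)) ⋄ (lam S.po fun z => eq 0 Y (k ⋄ z) (l ⋄ z)) ⋄ α ⋄ β ⋄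
      (lam S.X fun x => ref 336 ⋄ S.po ⋄ Y ⋄ k ⋄ l ⋄ S.inl (S.f ⋄ x) ⋄ S.inr (S.g ⋄ x) ⋄ S.glue x ⋄
        (α ⋄ (S.f ⋄ x)) ⋄ (β ⋄ (S.g ⋄ x)) ⋄ (γ ⋄ x)),
    pi S.po fun z => eq 0 Y (k ⋄ z) (l ⋄ z))

/-- The case of `pushoutExt` for functions that agree definitionally on both sides. -/
def pushoutExtRefl (S : Span) (Y k l γ : Syn) : Syn :=
  S.apply (ref 339) ⋄ Y ⋄ k ⋄ l ⋄ (lam S.A fun a => refl 0 Y (k ⋄ S.inl a)) ⋄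
    (lam S.B fun b => refl 0 Y (k ⋄ S.inr b)) ⋄
    lam S.X fun x =>
      let u := S.inl (S.f ⋄ x)
      let v := S.inr (S.g ⋄ x)
      let p := ap 0 S.po Y l u v (S.glue x)
      trans 0 (eq 0 Y (k ⋄ u) (l ⋄ v)) (trans 0 Y (k ⋄ u) (l ⋄ u) (l ⋄ v) (refl 0 Y (k ⋄ u)) p) p
        (ap 0 S.po Y k u v (S.glue x))
        (ref 330 ⋄ Y ⋄ (l ⋄ u) ⋄ (l ⋄ v) ⋄ p) (γ ⋄ x)

/-! #### Equality of types over a type -/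

/-- The inverse function of an equivalence. -/
def equivInv (i : ℕ) : Typed :=
  abs (U i) fun A => abs (U i) fun B => abs (A ⟹ B) fun f => abs (isEquiv i A B f) fun w =>
    -- The inverse is read off from the right inverse, because `f (g y) = y` is the law needed for
    -- univalence.
    (fst i (B ⟹ A) (fun g => pi B fun y => eq i B (f ⋄ (g ⋄ y)) y)
      (snd i (leftInv i A B f) (fun _ => rightInv i A B f) w), B ⟹ A)

def equivInvRight (i : ℕ) : Typed :=
  abs (U i) fun A => abs (U i) fun B => abs (A ⟹ B) fun f => abs (isEquiv i A B f) fun w =>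
    (snd i (B ⟹ A) (fun g => pi B fun y => eq i B (f ⋄ (g ⋄ y)) y)
      (snd i (leftInv i A B f) (fun _ => rightInv i A B f) w),
    pi B fun y => eq i B (f ⋄ (ref (340 + i) ⋄ A ⋄ B ⋄ f ⋄ w ⋄ y)) y)

/-- A function with an inverse is an equivalence. -/
def equivMk : Typed :=
  abs (U 0) fun A => abs (U 0) fun B => abs (A ⟹ B) fun f => abs (B ⟹ A) fun g =>
  abs (pi A fun x => eq 0 A (g ⋄ (f ⋄ x)) x) fun l =>
  abs (pi B fun y => eq 0 B (f ⋄ (g ⋄ y)) y) fun r =>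
    (pair 0 (leftInv 0 A B f) (fun _ => rightInv 0 A B f)
      (pair 0 (B ⟹ A) (fun g => pi A fun x => eq 0 A (g ⋄ (f ⋄ x)) x) g l)
      (pair 0 (B ⟹ A) (fun g => pi B fun y => eq 0 B (f ⋄ (g ⋄ y)) y) g r),
    isEquiv 0 A B f)

/-- Function extensionality. -/
def funextFun : Typed :=
  abs (U 0) fun A => abs (U 0) fun B => abs (A ⟹ B) fun f => abs (A ⟹ B) fun g =>
  abs (pi A fun x => eq 0 B (f ⋄ x) (g ⋄ x)) fun h =>
    (ref 340 ⋄ eq 0 (A ⟹ B) f g ⋄ (pi A fun x => eq 0 B (f ⋄ x) (g ⋄ x)) ⋄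
      ofTerm (HoTT.happly 0 (HoTT.bound 0) (fun _ => HoTT.bound 1) (HoTT.bound 2) (HoTT.bound 3)) ⋄
      (cst (.funext 0) ⋄ A ⋄ lam A (fun _ => B) ⋄ f ⋄ g) ⋄ h,
    eq 0 (A ⟹ B) f g)

/-- An equality of types under which two functions correspond gives an equality of types over
`C`. -/
def overEqOfEq : Typed :=
  abs (U 0) fun C => abs (U 0) fun X => abs (X ⟹ C) fun u => abs (U 0) fun Y =>
  abs (eq 1 (U 0) X Y) fun p =>
  let T := fun Y p => pi (Y ⟹ C) fun v =>
    pi (pi X fun x => eq 0 C (u ⋄ x) (v ⋄ (coe 0 X Y p ⋄ x))) fun _ =>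
    eq 1 (typeOver C) (obj C X u) (obj C Y v)
  -- Along `refl` the coercion computes to the identity, so the hypothesis becomes `u x = v x` and
  -- function extensionality identifies `u` with `v`.
  (eqInd 1 1 (U 0) X T
    (lam (X ⟹ C) fun v => lam (pi X fun x => eq 0 C (u ⋄ x) (v ⋄ x)) fun h =>
      eqInd 0 1 (X ⟹ C) u (fun v _ => eq 1 (typeOver C) (obj C X u) (obj C X v))
        (refl 1 (typeOver C) (obj C X u)) v (ref 345 ⋄ X ⋄ C ⋄ u ⋄ v ⋄ h)) Y p,
    T Y p)

/-- An equivalence under which two functions correspond gives an equality of types over `C`. -/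
def overEqOfEquiv : Typed :=
  abs (U 0) fun X => abs (U 0) fun Y => abs (U 0) fun C => abs (X ⟹ C) fun u =>
  abs (Y ⟹ C) fun v => abs (equiv 0 X Y) fun e =>
  let F := fun e => fst 0 (X ⟹ Y) (fun f => isEquiv 0 X Y f) e
  abs (pi X fun x => eq 0 C (u ⋄ x) (v ⋄ (F e ⋄ x))) fun h =>
  -- These are `X` and `Y`, the two outermost variables.
  let I := ofTerm (HoTT.idToEquiv 0 (HoTT.bound 0) (HoTT.bound 1))
  let w := eq 1 (U 0) X Y
  let a := cst (.univalence 0) ⋄ X ⋄ Y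
  let p := ref 341 ⋄ w ⋄ equiv 0 X Y ⋄ I ⋄ a ⋄ e
  -- The function underlying `I p` is coercion along `p` by computation, so it suffices to carry `h`
  -- back along `I p = e`.
  (ref 346 ⋄ C ⋄ X ⋄ u ⋄ Y ⋄ p ⋄ v ⋄
    transport 1 0 (equiv 0 X Y) (fun e => pi X fun x => eq 0 C (u ⋄ x) (v ⋄ (F e ⋄ x))) e (I ⋄ p)
      (symm 1 (equiv 0 X Y) (I ⋄ p) e (ref 343 ⋄ w ⋄ equiv 0 X Y ⋄ I ⋄ a ⋄ e)) h,
    eq 1 (typeOver C) (obj C X u) (obj C Y v))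

/-- A function with an inverse under which two functions to `C` correspond gives an equality of
types over `C`. -/
def overEq : Typed :=
  abs (U 0) fun C => abs (U 0) fun X => abs (X ⟹ C) fun u => abs (U 0) fun Y =>
  abs (Y ⟹ C) fun v => abs (X ⟹ Y) fun k => abs (Y ⟹ X) fun g =>
  abs (pi X fun x => eq 0 X (g ⋄ (k ⋄ x)) x) fun l =>
  abs (pi Y fun y => eq 0 Y (k ⋄ (g ⋄ y)) y) fun r =>
  abs (pi X fun x => eq 0 C (u ⋄ x) (v ⋄ (k ⋄ x))) fun h =>
  (ref 347 ⋄ X ⋄ Y ⋄ C ⋄ u ⋄ v ⋄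
    pair 0 (X ⟹ Y) (fun f => isEquiv 0 X Y f) k (ref 344 ⋄ X ⋄ Y ⋄ k ⋄ g ⋄ l ⋄ r) ⋄ h,
    eq 1 (typeOver C) (obj C X u) (obj C Y v))

/-! #### Families -/

/-- The total space of a family, as a type over the base. -/
def total : Typed :=
  abs (U 0) fun C => abs (C ⟹ U 0) fun P =>
    (obj C (sigma 0 C fun c => P ⋄ c)
      (lam (sigma 0 C fun c => P ⋄ c) fun w => fst 0 C (fun c => P ⋄ c) w), typeOver C)

def tot (C P : Syn) : Syn := ref 350 ⋄ C ⋄ P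

def fibers : Typed :=
  abs (U 0) fun C => abs (U 0) fun X => abs (X ⟹ C) fun u =>
    (lam C fun c => sigma 0 X fun x => eq 0 C (u ⋄ x) c, C ⟹ U 0)

/-- A type over `C` is the total space of the family of its fibers. -/
def totalFibers : Typed :=
  abs (U 0) fun C => abs (U 0) fun X => abs (X ⟹ C) fun u =>
  let P := ref 351 ⋄ C ⋄ X ⋄ u
  let B := fun c => P ⋄ c
  let Q := fun c x => eq 0 C (u ⋄ x) c
  let W := sigma 0 C B
  let k := lam X fun x => pair 0 C B (u ⋄ x) (pair 0 X (Q (u ⋄ x)) x (refl 0 C (u ⋄ x)))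
  let g := lam W fun w => fst 0 X (Q (fst 0 C B w)) (snd 0 C B w)
  (ref 348 ⋄ C ⋄ X ⋄ u ⋄ W ⋄ (lam W fun w => fst 0 C B w) ⋄ k ⋄ g ⋄ (lam X fun x => refl 0 X x) ⋄
    (lam W fun w => sigmaInd 0 0 C B (fun w => eq 0 W (k ⋄ (g ⋄ w)) w) (fun c f =>
      sigmaInd 0 0 X (Q c) (fun f => eq 0 W (k ⋄ (g ⋄ pair 0 C B c f)) (pair 0 C B c f))
        -- The point `(c, x, e)` contracts to `(u x, x, refl)` by induction on `e`; the other
        -- composite is the identity by computation.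
        (fun x e => eqInd 0 0 C (u ⋄ x)
          (fun c e => eq 0 W (k ⋄ x) (pair 0 C B c (pair 0 X (Q c) x e)))
          (refl 0 W (k ⋄ x)) c e) f) w) ⋄
    (lam X fun x => refl 0 C (u ⋄ x)),
    eq 1 (typeOver C) (obj C X u) (tot C P))

/-- To prove something for all types over `C`, it suffices to consider families. -/
def overInd : Typed :=
  abs (U 0) fun C => abs (typeOver C ⟹ U 1) fun T =>
  abs (pi (C ⟹ U 0) fun P => T ⋄ tot C P) fun t => abs (typeOver C) fun Z =>
  (sigmaInd 1 1 (U 0) (fun X => X ⟹ C) (fun Z => T ⋄ Z)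
    (fun X u =>
      let P := ref 351 ⋄ C ⋄ X ⋄ u
      transport 1 1 (typeOver C) (fun Z => T ⋄ Z) (tot C P) (obj C X u)
        (symm 1 (typeOver C) (obj C X u) (tot C P) (ref 352 ⋄ C ⋄ X ⋄ u)) (t ⋄ P)) Z,
    T ⋄ Z)

/-- Pullback of types over `C` along `g : D → C`. -/
def pullbackOver : Typed :=
  abs (U 0) fun C => abs (U 0) fun D => abs (D ⟹ C) fun g => abs (typeOver C) fun Z =>
  let S : Span := ⟨src C Z, D, C, str C Z, g⟩
  (obj D (pb S) (pbSnd S), typeOver D)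

def pbOver (C D g Z : Syn) : Syn := ref 354 ⋄ C ⋄ D ⋄ g ⋄ Z

/-- Join of types over `C`. -/
def joinOver : Typed :=
  abs (U 0) fun C => abs (typeOver C) fun Z => abs (typeOver C) fun W =>
  let S : Span := ⟨src C Z, src C W, C, str C Z, str C W⟩
  (obj C (jn S) (jnMap S), typeOver C)

def jnOver (C Z W : Syn) : Syn := ref 355 ⋄ C ⋄ Z ⋄ W

/-- The pullback of the total space of a family is the total space of the family on `D`. -/
def pullbackTotal : Typed :=
  abs (U 0) fun C => abs (U 0) fun D => abs (D ⟹ C) fun g => abs (C ⟹ U 0) fun P =>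
  let Pg := lam D fun d => P ⋄ (g ⋄ d)
  let B := fun c => P ⋄ c
  let B' := fun d => Pg ⋄ d
  let X := sigma 0 C B
  let W := sigma 0 D B'
  let S : Span := ⟨X, D, C, lam X fun w => fst 0 C B w, g⟩
  let Y := pb S
  let k := lam W fun w =>
    let d := fst 0 D B' w
    pbMk S (pair 0 C B (g ⋄ d) (snd 0 D B' w)) d (refl 0 C (g ⋄ d))
  let l := lam Y fun z =>
    let x := pbFst S ⋄ z
    let d := pbSnd S ⋄ z
    pair 0 D B' d (transport 0 0 C B (fst 0 C B x) (g ⋄ d) (pbPath S ⋄ z) (snd 0 C B x))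
  (ref 348 ⋄ D ⋄ W ⋄ (lam W fun w => fst 0 D B' w) ⋄ Y ⋄ pbSnd S ⋄ k ⋄ l ⋄
    (lam W fun w => sigmaInd 0 0 D B' (fun w => eq 0 W (l ⋄ (k ⋄ w)) w)
      (fun d p => refl 0 W (pair 0 D B' d p)) w) ⋄
    (lam Y fun z => pbInd S (fun z => eq 0 Y (k ⋄ (l ⋄ z)) z) (fun x d e =>
      let M := fun x e => eq 0 Y (k ⋄ (l ⋄ pbMk S x d e)) (pbMk S x d e)
      sigmaInd 0 0 C B (fun x => pi (eq 0 C (fst 0 C B x) (g ⋄ d)) fun e => M x e)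
        (fun c p => lam (eq 0 C c (g ⋄ d)) fun e =>
          -- The right end `g d` is not a variable, so the induction must move `c`, together with
          -- the point of `P c`.
          ref 337 ⋄ C ⋄ c ⋄ (g ⋄ d) ⋄ e ⋄
            (lam C fun c => lam (eq 0 C c (g ⋄ d)) fun e => pi (P ⋄ c) fun p =>
              M (pair 0 C B c p) e) ⋄
            (lam (P ⋄ (g ⋄ d)) fun p =>
              refl 0 Y (pbMk S (pair 0 C B (g ⋄ d) p) d (refl 0 C (g ⋄ d)))) ⋄ p)
        x ⋄ e) z) ⋄
    (lam W fun w => refl 0 D (fst 0 D B' w)),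
    eq 1 (typeOver D) (tot D Pg) (pbOver C D g (tot C P)))

/-! #### The join of total spaces -/

/-- Application of a composite of functions to a path, with a given value for the inner one. -/
def apCompEq : Typed :=
  abs (U 0) fun A => abs (U 0) fun B => abs (U 0) fun C => abs (A ⟹ B) fun f =>
  abs (B ⟹ C) fun g => abs A fun x => abs A fun y => abs (eq 0 A x y) fun p =>
  abs (eq 0 B (f ⋄ x) (f ⋄ y)) fun q =>
  let E := eq 0 B (f ⋄ x) (f ⋄ y)
  abs (eq 0 E (ap 0 A B f x y p) q) fun r =>
  let T := fun q _ => eq 0 (eq 0 C (g ⋄ (f ⋄ x)) (g ⋄ (f ⋄ y)))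
    (ap 0 A C (lam A fun x => g ⋄ (f ⋄ x)) x y p) (ap 0 B C g (f ⋄ x) (f ⋄ y) q)
  (eqInd 0 0 E (ap 0 A B f x y p) T (ref 332 ⋄ A ⋄ B ⋄ C ⋄ f ⋄ g ⋄ x ⋄ y ⋄ p) q r, T q r)

def fiberSpan (A B : Syn) : Span :=
  let X := prod 0 A B
  ⟨X, A, B, lam X fun s => fst 0 A (fun _ => B) s, lam X fun s => snd 0 A (fun _ => B) s⟩

/-- The family of joins of two families. -/
def fiberJoin : Typed :=
  abs (U 0) fun C => abs (C ⟹ U 0) fun P => abs (C ⟹ U 0) fun Q =>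
    (lam C fun c => (fiberSpan (P ⋄ c) (Q ⋄ c)).po, C ⟹ U 0)

/-- Two families over `C`. -/
structure Fams where
  (C P Q : Syn)

namespace Fams

variable (F : Fams)

def apply (t : Syn) : Syn := t ⋄ F.C ⋄ F.P ⋄ F.Q

def X : Syn := sigma 0 F.C fun c => F.P ⋄ c

def Y : Syn := sigma 0 F.C fun c => F.Q ⋄ c

def K : Syn := F.apply (ref 358)

def W : Syn := sigma 0 F.C fun c => F.K ⋄ c

def x (c p : Syn) : Syn := pair 0 F.C (fun c => F.P ⋄ c) c p

def y (c q : Syn) : Syn := pair 0 F.C (fun c => F.Q ⋄ c) c q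

def w (c z : Syn) : Syn := pair 0 F.C (fun c => F.K ⋄ c) c z

/-- The projections of the total spaces. -/
def S : Span :=
  ⟨F.X, F.Y, F.C, lam F.X fun x => fst 0 F.C (fun c => F.P ⋄ c) x,
    lam F.Y fun y => fst 0 F.C (fun c => F.Q ⋄ c) y⟩

def J : Span := joinSpan F.S

/-- The span over `c`. -/
def fs (c : Syn) : Span := fiberSpan (F.P ⋄ c) (F.Q ⋄ c)

/-- The element of the pullback given by points in the fibers over `c`. -/
def s (c p q : Syn) : Syn := pbMk F.S (F.x c p) (F.y c q) (refl 0 F.C c)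

def fiberInl (c : Syn) : Syn := lam (F.P ⋄ c) fun p => F.J.inl (F.x c p)

def fiberInr (c : Syn) : Syn := lam (F.Q ⋄ c) fun q => F.J.inr (F.y c q)

def fiberGlue (c : Syn) : Syn :=
  lam (F.fs c).X fun s => F.J.glue (F.s c ((F.fs c).f ⋄ s) ((F.fs c).g ⋄ s))

/-- The map from the fiber over `c` to the join. -/
def fiberMap (c : Syn) : Syn := F.apply (ref 359) ⋄ c

/-- The map from the total space of the family of joins to the join. -/
def toJoin : Syn := F.apply (ref 373)

def invInl : Syn :=
  lam F.X fun x => sigmaInd 0 0 F.C (fun c => F.P ⋄ c) (fun _ => F.W)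
    (fun c p => F.w c ((F.fs c).inl p)) x

def invInr : Syn :=
  lam F.Y fun y => sigmaInd 0 0 F.C (fun c => F.Q ⋄ c) (fun _ => F.W)
    (fun c q => F.w c ((F.fs c).inr q)) y

/-- The path in the fiber over `c`, in the total space. -/
def fiberPath (c p q : Syn) : Syn :=
  ap 0 (F.fs c).po F.W (lam (F.fs c).po fun z => F.w c z) ((F.fs c).inl p) ((F.fs c).inr q)
    ((F.fs c).glue (pair 0 (F.P ⋄ c) (fun _ => F.Q ⋄ c) p q))

def invGlue : Syn := F.apply (ref 361)

def ofJoin : Syn := F.apply (ref 362)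

end Fams

def absFams (T : Fams → Typed) : Typed :=
  abs (U 0) fun C => abs (C ⟹ U 0) fun P => abs (C ⟹ U 0) fun Q => T ⟨C, P, Q⟩

def fiberMap : Typed :=
  absFams fun F => abs F.C fun c =>
    ((F.fs c).recFun (jn F.S) (F.fiberInl c) (F.fiberInr c) (F.fiberGlue c),
      (F.fs c).po ⟹ jn F.S)

def toJoin : Typed :=
  absFams fun F => abs F.W fun w =>
    (sigmaInd 0 0 F.C (fun c => F.K ⋄ c) (fun _ => jn F.S) (fun c z => F.fiberMap c ⋄ z) w, jn F.S)

/-- Induction on an element of the pullback of two total spaces. -/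
def totalInd : Typed :=
  absFams fun F => abs (pb F.S ⟹ U 0) fun M =>
  abs (pi F.C fun c => pi (F.P ⋄ c) fun p => pi (F.Q ⋄ c) fun q => M ⋄ F.s c p q) fun m =>
  abs (pb F.S) fun s =>
  (pbInd F.S (fun s => M ⋄ s) (fun x y e =>
    sigmaInd 0 0 F.C (fun c => F.P ⋄ c)
      (fun x => pi F.Y fun y => pi (eq 0 F.C (F.S.f ⋄ x) (F.S.g ⋄ y)) fun e =>
        M ⋄ pbMk F.S x y e)
      (fun c p => lam F.Y fun y => lam (eq 0 F.C c (F.S.g ⋄ y)) fun e =>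
        sigmaInd 0 0 F.C (fun c => F.Q ⋄ c)
          (fun y => pi (eq 0 F.C c (F.S.g ⋄ y)) fun e => M ⋄ pbMk F.S (F.x c p) y e)
          (fun c' q => lam (eq 0 F.C c c') fun e =>
            -- The induction on `e` moves its end `c'`, so `q : Q c'` is generalized with it.
            eqInd 0 0 F.C c
              (fun c' e => pi (F.Q ⋄ c') fun q => M ⋄ pbMk F.S (F.x c p) (F.y c' q) e)
              (lam (F.Q ⋄ c) fun q => m ⋄ c ⋄ p ⋄ q) c' e ⋄ q)
          y ⋄ e)
      x ⋄ y ⋄ e) s,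
    M ⋄ s)

/-- Induction reduces to two points over the same `c` with the reflexivity path, where the glue path
of the fiber does the job. As `totalInd` computes there, the value at `F.s c p q` is `F.fiberPath c
p q` by definition. -/
def invGlue : Typed :=
  absFams fun F => abs (pb F.S) fun s =>
  let T := fun s => eq 0 F.W (F.invInl ⋄ (pbFst F.S ⋄ s)) (F.invInr ⋄ (pbSnd F.S ⋄ s))
  (F.apply (ref 360) ⋄ lam (pb F.S) T ⋄
    (lam F.C fun c => lam (F.P ⋄ c) fun p => lam (F.Q ⋄ c) fun q => F.fiberPath c p q) ⋄ s,
    T s)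

def ofJoin : Typed :=
  absFams fun F => (F.J.recFun F.W F.invInl F.invInr F.invGlue, jn F.S ⟹ F.W)

namespace Fams

variable (F : Fams)

/-- The effect of `fiberMap` on the paths. -/
def fiberMapGlue (c s : Syn) : Syn :=
  (F.fs c).apply (ref 338) ⋄ jn F.S ⋄ F.fiberInl c ⋄ F.fiberInr c ⋄ F.fiberGlue c ⋄ s

/-- The effect of `ofJoin` on the path over `s c p q`. -/
def ofJoinGlue (s : Syn) : Syn :=
  F.J.apply (ref 338) ⋄ F.W ⋄ F.invInl ⋄ F.invInr ⋄ F.invGlue ⋄ s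

end Fams

/-- The composite of `ofJoin` and `toJoin` is the identity on the paths. -/
def toJoinOfJoinGlue : Typed :=
  absFams fun F => abs F.C fun c => abs (F.P ⋄ c) fun p => abs (F.Q ⋄ c) fun q =>
  let T := F.fs c
  let s := pair 0 (F.P ⋄ c) (fun _ => F.Q ⋄ c) p q
  let G := F.J.glue (F.s c p q)
  let u := F.J.inl (F.x c p)
  let v := F.J.inr (F.y c q)
  let E := eq 0 (jn F.S) u v
  let b := ap 0 T.po (jn F.S) (F.fiberMap c) (T.inl p) (T.inr q) (T.glue s)
  let r := F.fiberPath c p q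
  let d := ap 0 F.W (jn F.S) F.toJoin (F.w c (T.inl p)) (F.w c (T.inr q)) r
  let e := ap 0 (jn F.S) (jn F.S) (lam (jn F.S) fun j => F.toJoin ⋄ (F.ofJoin ⋄ j)) u v G
  -- On the fiber over `c`, `toJoin` computes to `fiberMap c`; hence it sends `fiberPath` to `G`,
  -- while `ofJoin` sends `G` to `fiberPath`.
  (chain 0 E G b (symm 0 E b G (F.fiberMapGlue c s))
    [(ref 332 ⋄ T.po ⋄ F.W ⋄ jn F.S ⋄ (lam T.po fun z => F.w c z) ⋄ F.toJoin ⋄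
      T.inl p ⋄ T.inr q ⋄ T.glue s, d),
    (symm 0 E e d (ref 357 ⋄ jn F.S ⋄ F.W ⋄ jn F.S ⋄ F.ofJoin ⋄ F.toJoin ⋄ u ⋄ v ⋄ G ⋄ r ⋄
      F.ofJoinGlue (F.s c p q)), e)],
    eq 0 E G e)

/-- The homotopies on both sides become `refl` once a point of a total space is a pair. So the path
condition is proved by `totalInd`, where it reduces to `toJoinOfJoinGlue` and the unit laws. -/
def toJoinOfJoin : Typed :=
  absFams fun F =>
  let J := F.J
  let k := lam (jn F.S) fun j => F.toJoin ⋄ (F.ofJoin ⋄ j)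
  let l := lam (jn F.S) fun j => j
  let α := lam F.X fun x => sigmaInd 0 0 F.C (fun c => F.P ⋄ c)
    (fun x => eq 0 (jn F.S) (k ⋄ J.inl x) (J.inl x)) (fun c p => refl 0 (jn F.S) (J.inl (F.x c p))) x
  let β := lam F.Y fun y => sigmaInd 0 0 F.C (fun c => F.Q ⋄ c)
    (fun y => eq 0 (jn F.S) (k ⋄ J.inr y) (J.inr y)) (fun c q => refl 0 (jn F.S) (J.inr (F.y c q))) y
  let M := lam (pb F.S) fun s =>
    let u := J.inl (J.f ⋄ s)
    let v := J.inr (J.g ⋄ s)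
    eq 0 (eq 0 (jn F.S) (k ⋄ u) v)
      (trans 0 (jn F.S) (k ⋄ u) u v (α ⋄ (J.f ⋄ s)) (ap 0 (jn F.S) (jn F.S) l u v (J.glue s)))
      (trans 0 (jn F.S) (k ⋄ u) (k ⋄ v) v (ap 0 (jn F.S) (jn F.S) k u v (J.glue s))
        (β ⋄ (J.g ⋄ s)))
  (J.apply (ref 339) ⋄ jn F.S ⋄ k ⋄ l ⋄ α ⋄ β ⋄
    (lam (pb F.S) fun s => F.apply (ref 360) ⋄ M ⋄
      (lam F.C fun c => lam (F.P ⋄ c) fun p => lam (F.Q ⋄ c) fun q =>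
        let G := J.glue (F.s c p q)
        let u := J.inl (F.x c p)
        let v := J.inr (F.y c q)
        let a := ap 0 (jn F.S) (jn F.S) l u v G
        chain 0 (eq 0 (jn F.S) u v) (trans 0 (jn F.S) u u v (refl 0 (jn F.S) u) a) a
          (ref 330 ⋄ jn F.S ⋄ u ⋄ v ⋄ a)
          [(ref 333 ⋄ jn F.S ⋄ u ⋄ v ⋄ G, G),
          (F.apply (ref 374) ⋄ c ⋄ p ⋄ q, ap 0 (jn F.S) (jn F.S) k u v G)]) ⋄ s),
    pi (jn F.S) fun j => eq 0 (jn F.S) (F.toJoin ⋄ (F.ofJoin ⋄ j)) j)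

/-- With `c` fixed, both maps from the fiber agree by definition on `inl` and `inr`. On the glue
path, `fiberMap` gives the glue path of the join, which `ofJoin` sends to `fiberPath`. -/
def ofJoinToJoin : Typed :=
  absFams fun F => abs F.W fun w =>
  let B := fun c => F.K ⋄ c
  (sigmaInd 0 0 F.C B (fun w => eq 0 F.W (F.ofJoin ⋄ (F.toJoin ⋄ w)) w) (fun c z =>
    let T := F.fs c
    let k := lam T.po fun z => F.ofJoin ⋄ (F.fiberMap c ⋄ z)
    let l := lam T.po fun z => F.w c z
    let M := fun s =>
      let u := T.inl (T.f ⋄ s)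
      let v := T.inr (T.g ⋄ s)
      eq 0 (eq 0 F.W (k ⋄ u) (l ⋄ v)) (ap 0 T.po F.W l u v (T.glue s))
        (ap 0 T.po F.W k u v (T.glue s))
    pushoutExtRefl T F.W k l (lam T.X fun s => sigmaInd 0 0 (F.P ⋄ c) (fun _ => F.Q ⋄ c) M
      (fun p q =>
        let s := pair 0 (F.P ⋄ c) (fun _ => F.Q ⋄ c) p q
        let s' := F.s c p q
        let u := F.w c (T.inl p)
        let v := F.w c (T.inr q)
        let a := ap 0 T.po F.W k (T.inl p) (T.inr q) (T.glue s)
        let b := ap 0 (jn F.S) F.W F.ofJoin (F.J.inl (F.x c p)) (F.J.inr (F.y c q)) (F.J.glue s')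
        let r := F.fiberPath c p q
        symm 0 (eq 0 F.W u v) a r (trans 0 (eq 0 F.W u v) a b r
          (ref 357 ⋄ T.po ⋄ jn F.S ⋄ F.W ⋄ F.fiberMap c ⋄ F.ofJoin ⋄ T.inl p ⋄ T.inr q ⋄
            T.glue s ⋄ F.J.glue s' ⋄ F.fiberMapGlue c s) (F.ofJoinGlue s'))) s) ⋄ z) w,
    eq 0 F.W (F.ofJoin ⋄ (F.toJoin ⋄ w)) w)

/-- Over a fixed `c` the join map composed with `fiberMap c` is compared with the constant map `c`:
both send the glue path to `refl`, since the path component of `F.s c p q` is `refl`. -/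
def toJoinOver : Typed :=
  absFams fun F => abs F.W fun w =>
  let B := fun c => F.K ⋄ c
  let E := fun w => eq 0 F.C (fst 0 F.C B w) (jnMap F.S ⋄ (F.toJoin ⋄ w))
  (sigmaInd 0 0 F.C B E (fun c z =>
    let T := F.fs c
    let k := lam T.po fun _ => c
    let l := lam T.po fun z => jnMap F.S ⋄ (F.fiberMap c ⋄ z)
    pushoutExtRefl T F.C k l (lam T.X fun s =>
      let p := T.f ⋄ s
      let q := T.g ⋄ s
      let s' := F.s c p q
      let R := refl 0 F.C c
      let a := ap 0 T.po F.C l (T.inl p) (T.inr q) (T.glue s)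
      let b := ap 0 (jn F.S) F.C (jnMap F.S) (F.J.inl (F.x c p)) (F.J.inr (F.y c q)) (F.J.glue s')
      let d := ap 0 T.po F.C k (T.inl p) (T.inr q) (T.glue s)
      chain 0 (eq 0 F.C c c) a b
        (ref 357 ⋄ T.po ⋄ jn F.S ⋄ F.C ⋄ F.fiberMap c ⋄ jnMap F.S ⋄ T.inl p ⋄ T.inr q ⋄
          T.glue s ⋄ F.J.glue s' ⋄ F.fiberMapGlue c s)
        [(F.J.apply (ref 338) ⋄ F.C ⋄ F.S.f ⋄ F.S.g ⋄ pbPath F.S ⋄ s', R),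
        (symm 0 (eq 0 F.C c c) d R
          (ref 334 ⋄ T.po ⋄ F.C ⋄ c ⋄ T.inl p ⋄ T.inr q ⋄ T.glue s), d)]) ⋄ z) w,
    E w)

/-- The join of two total spaces is the total space of the family of joins. -/
def joinTotal : Typed :=
  absFams fun F =>
  (ref 348 ⋄ F.C ⋄ F.W ⋄ (lam F.W fun w => fst 0 F.C (fun c => F.K ⋄ c) w) ⋄ jn F.S ⋄ jnMap F.S ⋄
    F.toJoin ⋄ F.ofJoin ⋄ F.apply (ref 364) ⋄ F.apply (ref 363) ⋄ F.apply (ref 365),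
    eq 1 (typeOver F.C) (tot F.C F.K) (jnOver F.C (tot F.C F.P) (tot F.C F.Q)))

/-! #### Pullbacks of iterated joins -/

/-- Joins are stable under pullback. -/
def joinPullback : Typed :=
  abs (U 0) fun C => abs (U 0) fun D => abs (D ⟹ C) fun g => abs (typeOver C) fun Z =>
  abs (typeOver C) fun W =>
  let O := typeOver D
  let T := fun Z W => eq 1 O (pbOver C D g (jnOver C Z W))
    (jnOver D (pbOver C D g Z) (pbOver C D g W))
  -- Two uses of `overInd` replace `Z` and `W` by total spaces.
  (ref 353 ⋄ C ⋄ (lam (typeOver C) fun Z => pi (typeOver C) fun W => T Z W) ⋄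
    (lam (C ⟹ U 0) fun P => lam (typeOver C) fun W =>
      ref 353 ⋄ C ⋄ (lam (typeOver C) fun W => T (tot C P) W) ⋄
        (lam (C ⟹ U 0) fun Q =>
          let K := ref 358 ⋄ C ⋄ P ⋄ Q
          let Pg := lam D fun d => P ⋄ (g ⋄ d)
          let Qg := lam D fun d => Q ⋄ (g ⋄ d)
          let Kg := lam D fun d => K ⋄ (g ⋄ d)
          let b := fun P => pbOver C D g (tot C P)
          let J := jnOver C (tot C P) (tot C Q)
          let e := fun P => ref 356 ⋄ C ⋄ D ⋄ g ⋄ P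
          chain 1 O (pbOver C D g J) (b K)
            (symm 1 O (b K) (pbOver C D g J)
              (ap 1 (typeOver C) O (ref 354 ⋄ C ⋄ D ⋄ g) (tot C K) J (ref 366 ⋄ C ⋄ P ⋄ Q)))
            [(symm 1 O (tot D Kg) (b K) (e K), tot D Kg),
            -- This fits because `Kg` is definitionally the family of joins of `Pg` and `Qg`.
            (ref 366 ⋄ D ⋄ Pg ⋄ Qg, jnOver D (tot D Pg) (tot D Qg)),
            (ap 1 O O (lam O fun Z => jnOver D Z (tot D Qg)) (tot D Pg) (b P) (e P),
              jnOver D (b P) (tot D Qg)),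
            (ap 1 O O (lam O fun Z => jnOver D (b P) Z) (tot D Qg) (b Q) (e Q),
              jnOver D (b P) (b Q))]) ⋄ W) ⋄ Z ⋄ W,
    T Z W)

/-- Iterated joins are stable under pullback. -/
def iterJoinPullback : Typed :=
  abs (U 0) fun A => abs (U 0) fun C => abs (U 0) fun D => abs (A ⟹ C) fun f =>
  abs (D ⟹ C) fun g => abs nat fun n =>
  let O := typeOver D
  let S : Span := ⟨A, D, C, f, g⟩
  let T := fun n => eq 1 O (pbOver C D g (itJoin A C f n)) (itJoin (pb S) D (pbSnd S) n)
  let elim := fun M z => cst (.emptyInd 0) ⋄ lam empty (fun _ => M) ⋄ z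
  let S₀ : Span := ⟨empty, D, C, cst (.emptyInd 0) ⋄ lam empty fun _ => C, g⟩
  let v := cst (.emptyInd 0) ⋄ lam empty fun _ => D
  let k := pbFst S₀
  let l := cst (.emptyInd 0) ⋄ lam empty fun _ => pb S₀
  (cst (.natInd 1) ⋄ lam nat T ⋄
    -- For `n = 0` the pullback maps to the empty type by its first projection, so everything about
    -- it follows.
    (ref 348 ⋄ D ⋄ pb S₀ ⋄ pbSnd S₀ ⋄ empty ⋄ v ⋄ k ⋄ l ⋄
      (lam (pb S₀) fun z => elim (eq 0 (pb S₀) (l ⋄ (k ⋄ z)) z) (k ⋄ z)) ⋄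
      (lam empty fun y => elim (eq 0 empty (k ⋄ (l ⋄ y)) y) y) ⋄
      (lam (pb S₀) fun z => elim (eq 0 D (pbSnd S₀ ⋄ z) (v ⋄ (k ⋄ z))) (k ⋄ z))) ⋄
    (lam nat fun n => lam (T n) fun h =>
      let Z := itJoin A C f n
      let V := obj C A f
      let V' := pbOver C D g V
      let I := itJoin (pb S) D (pbSnd S) n
      -- The outer terms are, by computation of the recursion on `ℕ`, the two sides for `n + 1`.
      trans 1 O (pbOver C D g (jnOver C Z V)) (jnOver D (pbOver C D g Z) V') (jnOver D I V')
        (ref 367 ⋄ C ⋄ D ⋄ g ⋄ Z ⋄ V)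
        (ap 1 O O (lam O fun Z => jnOver D Z V') (pbOver C D g Z) I h)) ⋄ n,
    T n)

/-! #### The comparison map -/

/-- The map from a join to itself given by the constructors is an equivalence. -/
def joinSelfEquiv : Typed :=
  absCospan fun S =>
  let J := joinSpan S
  let i₁ := J.apply (cst (.inl 0))
  let i₂ := J.apply (cst (.inr 0))
  let h := lam (pb S) fun z => J.glue z
  let k := J.recFun (jn S) i₁ i₂ h
  let I := lam (jn S) fun z => z
  let H := pushoutExtRefl J (jn S) k I (lam (pb S) fun x =>
    let u := J.inl (J.f ⋄ x)
    let v := J.inr (J.g ⋄ x)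
    let a := ap 0 J.po (jn S) k u v (J.glue x)
    let E := eq 0 (jn S) u v
    trans 0 E (ap 0 J.po (jn S) I u v (J.glue x)) (J.glue x) a
      (ref 333 ⋄ jn S ⋄ u ⋄ v ⋄ J.glue x)
      (symm 0 E a (J.glue x) (J.apply (ref 338) ⋄ jn S ⋄ i₁ ⋄ i₂ ⋄ h ⋄ x)))
  -- The inverse is the identity, so one homotopy from `k` to the identity serves as both laws.
  (ref 344 ⋄ jn S ⋄ jn S ⋄ k ⋄ I ⋄ H ⋄ H, isEquiv 0 (jn S) (jn S) k)

/-- The span of which the square is compared with the pushout. -/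
def squareSpan (S : Span) (Y r p : Syn) : Span := ⟨Y, S.X, S.A, left S Y r p, r⟩

/-- The type which says that `Y` is the pullback over `S.A` and that the comparison map to `L` is an
equivalence. -/
def claim (S : Span) (Y r L : Syn) : Syn :=
  sigma 1 (eq 1 (U 0) (pb S) Y) fun p => sigma 0 (overTy S Y r p) fun h =>
    ref 310 ⋄ (squareSpan S Y r p).po ⋄ L ⋄ comp S Y r p h

/-- The equality is one of types over `S.A`, so a single path induction makes `Y` the pullback and
its map the second projection. With `p` and `h` trivial, the coercion disappears and the path `glue
· ap i₂ refl` computes to `glue`; the comparison map is then the one of `joinSelfEquiv`. -/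
def squareClaim : Typed :=
  absCospan fun S => abs (typeOver S.A) fun Z =>
  let O := typeOver S.A
  let V := obj S.A (pb S) (pbSnd S)
  abs (eq 1 O V Z) fun q =>
  let T := fun Z => claim S (src S.A Z) (str S.A Z) (jn S)
  let Y := pb S
  let r := pbSnd S
  let C := fun p h => ref 310 ⋄ (squareSpan S Y r p).po ⋄ jn S ⋄ comp S Y r p h
  let R := refl 1 (U 0) Y
  (eqInd 1 1 O V (fun Z _ => T Z)
    (pair 1 (eq 1 (U 0) (pb S) Y) (fun p => sigma 0 (overTy S Y r p) fun h => C p h) R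
      (pair 0 (overTy S Y r R) (fun h => C R h) (lam (pb S) fun z => refl 0 S.A (r ⋄ z))
        (S.apply (ref 369)))) Z q,
    T Z)

/-! #### Lens spaces -/

/-- The claim on lens spaces. -/
def lensClaim (B f n : Syn) : Syn :=
  let S1 := cst .circle
  let R : Span := ⟨S1, S1, B, f, f⟩
  claim ⟨itType S1 B f n, S1, B, itMap S1 B f n, f⟩ (itType (pb R) S1 (pbSnd R) n)
    (itMap (pb R) S1 (pbSnd R) n) (itType S1 B f (cst .succ ⋄ n))

/-- This is base change for iterated joins along `f` itself, fed into `squareClaim`; the join of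
`Lⁿ` with the circle computes to `Lⁿ⁺¹`. -/
def lensTheorem : Typed :=
  abs (U 0) fun B => abs (cst .circle ⟹ B) fun f => abs nat fun n =>
    let S1 := cst .circle
    let R : Span := ⟨S1, S1, B, f, f⟩
    let S : Span := ⟨itType S1 B f n, S1, B, itMap S1 B f n, f⟩
    (S.apply (ref 370) ⋄ itJoin (pb R) S1 (pbSnd R) n ⋄ (ref 368 ⋄ S1 ⋄ B ⋄ S1 ⋄ f ⋄ f ⋄ n),
      lensClaim B f n)

def lensPushout : Typed :=
  -- Variables are counted from the outside: `v 0`, `v 1`, `v 2`, `v 4`, `v 6`, `v 7` are the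
  -- modulus, `B`, its base point, the equivalence, `f` and its pointing.
  let v := HoTT.bound
  abs nat fun _ => abs (U 0) fun B => abs B fun b => abs (ofTerm (HoTT.isConnected (v 1))) fun _ =>
  abs (ofTerm (HoTT.equiv 0 (HoTT.zmod (v 0)) (HoTT.Loop (v 1) (v 2)))) fun _ =>
  abs (ofTerm (HoTT.isGroupHom (v 0) (v 1) (v 2) (v 4))) fun _ =>
  abs (cst .circle ⟹ B) fun f => abs (eq 0 B (f ⋄ cst .base) b) fun _ =>
  abs (ofTerm (HoTT.deloopsQuotient (v 0) (v 1) (v 2) (v 4) (v 6) (v 7))) fun _ =>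
  abs nat fun n => (ref 371 ⋄ B ⋄ f ⋄ n, lensClaim B f n)

/-- The library of all definitions; the numbers are those in the references. -/
def library : Library :=
  List.reverse [entry 330 reflTrans, entry 331 cancelLeft, entry 332 apComp, entry 333 apId,
    entry 334 apConst, entry 335 apdConst, entry 336 transportEq, entry 337 eqIndRight,
    entry 338 recGlue, entry 339 pushoutExt, entry 340 (equivInv 0), entry 341 (equivInv 1),
    entry 343 (equivInvRight 1), entry 344 equivMk, entry 345 funextFun, entry 346 overEqOfEq,
    entry 347 overEqOfEquiv, entry 348 overEq, entry 350 total, entry 351 fibers,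
    entry 352 totalFibers, entry 353 overInd, entry 354 pullbackOver, entry 355 joinOver,
    entry 356 pullbackTotal, entry 357 apCompEq, entry 358 fiberJoin, entry 359 fiberMap,
    entry 360 totalInd, entry 361 invGlue, entry 362 ofJoin, entry 373 toJoin,
    entry 374 toJoinOfJoinGlue, entry 363 toJoinOfJoin, entry 364 ofJoinToJoin,
    entry 365 toJoinOver, entry 366 joinTotal, entry 367 joinPullback, entry 368 iterJoinPullback,
    entry 369 joinSelfEquiv, entry 370 squareClaim, entry 371 lensTheorem, entry 372 lensPushout] ++
  joinLibrary

/-- Evaluation of the checker on every entry; `1000` bounds the recursion depth of checking, of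
conversion and of head reduction alike. -/
theorem library_good : library.Good := Library.good_of_ok (N := 1000) (by decide +kernel)

end Syn

end HoTT

theorem mainTheorem2 : HoTT.Provable HoTT.lensPushout := by
  have h := HoTT.Syn.library_good.sound.hasType 372 (HoTT.Syn.entry 372 HoTT.Syn.lensPushout).2 rfl
  -- With its references unfolded, the type of the last entry is literally the raw term of the
  -- statement.
  rw [show (HoTT.Syn.entry 372 HoTT.Syn.lensPushout).2.2.expand HoTT.Syn.library.den =
    HoTT.lensPushout 0 from HoTT.Raw.eq_of_beq (by decide +kernel)] at h
  exact ⟨_, h⟩
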